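/- Let $N\ge 1$, let $\Omega\subset\mathbb R^N$ be open with $0\in\Omega$, and let $a:\Omega\to\mathbb R^{N\times N}$, $g:\Omega\to\mathbb R^N$ be $C^\infty$ with $g(0)=0$, such that $a(0)$ has only real, simple eigenvalues. Let $\delta>0$ with $B_{2\delta}(0)\subset\Omega$, and let $\lambda_i:B_{2\delta}(0)\to\mathbb R$, $l_i:B_{2\delta}(0)\to\mathbb R^{1\times N}$, $r_i:B_{2\delta}(0)\to\mathbb R^{N\times 1}$ $(1\le i\le N)$ be $C^\infty$ functions with $$l_i a=\lambda_i l_i,\qquad a r_i=\lambda_i r_i,\qquad \lambda_i<\lambda_j\ (i<j),\qquad |l_i|=1,\qquad l_ir_j=\delta_{ij}$$ on $B_{2\delta}(0)$. Fix $p\in\{1,\dots,N\}$ such that the $p$-th eigenvalue is genuinely nonlinear at $0$, with the sign normalized so that $\langle D\lambda_p(0),r_p(0)\rangle<0$. Put $$\gamma_{ppp}(0):=-\frac{d}{ds}\Big(l_p(0)\,a(s\,r_p(0))\,r_p(0)\Big)\Big|_{s=0}\ \big(=-\langle D\lambda_p(0),r_p(0)\rangle>0\big).$$ Let $U:I\to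 B_\delta(0)$ be an integral curve of $r_p$ on an open interval $I\ni 0$, i.e. $U'(\xi)=r_p(U(\xi))$ for $\xi\in I$ and $U(0)=0$. Let $\alpha\in C_c^\infty(\mathbb R)$ with $\alpha(\mathbb R)\subset I$, $\operatorname{supp}\alpha\subset(-1/2,1/2)$ and $\max|\alpha'|=\max\alpha'>0$. For $\varepsilon\in(0,1]$ put $u^{0\varepsilon}(x)=U(\varepsilon\alpha(x))$, and let $$\overline T:=\frac{4}{\gamma_{ppp}(0)\,\max\alpha'} .$$ Then there exists $\nu\in(0,1]$ such that for all $\varepsilon,\kappa\in(0,\nu]$ and $T>0$: if a function $u\in C^2([0,T]\times\mathbb R)$ with values in $\Omega$ solves $$u_t+a(u)u_x=\varepsilon\kappa\, g(u),\qquad u(0,x)=u^{0\varepsilon}(x),$$ then $$T<T_\varepsilon:=\tfrac34\,\overline T\,\varepsilon^{-1}.$$ -/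

import Mathlib

open Set
open scoped ContDiff

noncomputable section

/-- The Euclidean space `ℝ^N`. -/
abbrev RN (N : ℕ) : Type := EuclideanSpace ℝ (Fin N)

/-- The matrix `A` has only real, simple eigenvalues. -/
def OnlyRealSimpleEigenvalues {N : ℕ} (A : Matrix (Fin N) (Fin N) ℝ) : Prop :=
  A.charpoly.Splits ∧ A.charpoly.roots.Nodup

/-- `lam i`, `l i`, `r i` are, on the ball `B_{2δ}(0) ⊆ Ω`, smooth ordered eigenvalues, left
eigenvectors (rows) and right eigenvectors (columns) of `a`, normalized by `|l_i| = 1` and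
`l_i r_j = δ_{ij}`. -/
structure IsEigenframe {N : ℕ} (Ω : Set (RN N)) (a : RN N → Matrix (Fin N) (Fin N) ℝ) (δ : ℝ)
    (lam : Fin N → RN N → ℝ) (l r : Fin N → RN N → RN N) : Prop where
  pos : 0 < δ
  ball_subset : Metric.ball (0 : RN N) (2 * δ) ⊆ Ω
  smooth_lam : ∀ i, ContDiffOn ℝ ∞ (lam i) (Metric.ball 0 (2 * δ))
  smooth_l : ∀ i, ContDiffOn ℝ ∞ (l i) (Metric.ball 0 (2 * δ))
  smooth_r : ∀ i, ContDiffOn ℝ ∞ (r i) (Metric.ball 0 (2 * δ))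
  left_eigen : ∀ v ∈ Metric.ball (0 : RN N) (2 * δ), ∀ i n,
    ∑ m, l i v m * a v m n = lam i v * l i v n
  right_eigen : ∀ v ∈ Metric.ball (0 : RN N) (2 * δ), ∀ i m,
    ∑ n, a v m n * r i v n = lam i v * r i v m
  ordered : ∀ v ∈ Metric.ball (0 : RN N) (2 * δ), ∀ i j, i < j → lam i v < lam j v
  norm_l : ∀ v ∈ Metric.ball (0 : RN N) (2 * δ), ∀ i, ‖l i v‖ = 1
  biorthogonal : ∀ v ∈ Metric.ball (0 : RN N) (2 * δ), ∀ i j,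
    ∑ m, l i v m * r j v m = if i = j then 1 else 0

/-- `c_{ijk}(v) = d/ds (l_i(v) a(v + s r_k(v)) r_j(v))` at `s = 0`. -/
def cCoeff {N : ℕ} (a : RN N → Matrix (Fin N) (Fin N) ℝ) (l r : Fin N → RN N → RN N)
    (i j k : Fin N) (v : RN N) : ℝ :=
  deriv (fun s : ℝ => ∑ m, ∑ n, l i v m * a (v + s • r k v) m n * r j v n) 0

/-- The diagonal coefficient `γ_{iii} = - c_{iii}`. -/
def gammaDiag {N : ℕ} (a : RN N → Matrix (Fin N) (Fin N) ℝ) (l r : Fin N → RN N → RN N)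
    (i : Fin N) (v : RN N) : ℝ :=
  - cCoeff a l r i i i v

/-- `U : I → B_δ(0)` is an integral curve through `0` of the vector field `rp`, defined on the
open interval `I ∋ 0`. -/
structure IsIntegralCurveThroughZero {N : ℕ} (rp : RN N → RN N) (δ : ℝ) (I : Set ℝ)
    (U : ℝ → RN N) : Prop where
  isOpen : IsOpen I
  ordConnected : I.OrdConnected
  zero_mem : (0 : ℝ) ∈ I
  mapsTo : ∀ ξ ∈ I, U ξ ∈ Metric.ball (0 : RN N) δ
  hasDerivAt : ∀ ξ ∈ I, HasDerivAt U (rp (U ξ)) ξ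
  at_zero : U 0 = 0

/-- The profile `α ∈ C_c^∞(ℝ)`: `α(ℝ) ⊆ I`, `supp α ⊆ (-1/2, 1/2)` and
`max |α'| = max α' > 0`. (The derivative is continuous with compact support, so the
suprema are maxima.) -/
structure IsProfile (I : Set ℝ) (α : ℝ → ℝ) : Prop where
  smooth : ContDiff ℝ ∞ α
  range_subset : ∀ x, α x ∈ I
  support_subset : tsupport α ⊆ Ioo (-1 / 2 : ℝ) (1 / 2)
  max_abs_eq : (⨆ x, |deriv α x|) = ⨆ x, deriv α x
  max_pos : 0 < ⨆ x, deriv α x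

/-- `u` is a `C^2([0,T] × ℝ)` solution, with values in `Ω`, of the Cauchy problem
`u_t + a(u) u_x = σ g(u)`, `u(0, ·) = u0`. -/
structure IsC2Solution {N : ℕ} (Ω : Set (RN N)) (a : RN N → Matrix (Fin N) (Fin N) ℝ)
    (g : RN N → RN N) (σ : ℝ) (u0 : ℝ → RN N) (T : ℝ) (u : ℝ → ℝ → RN N) : Prop where
  mem : ∀ t ∈ Icc 0 T, ∀ x, u t x ∈ Ω
  contDiffOn : ContDiffOn ℝ 2 (fun q : ℝ × ℝ => u q.1 q.2) (Icc 0 T ×ˢ univ)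
  equation : ∀ t ∈ Ioo 0 T, ∀ x, ∀ m,
    deriv (fun s => u s x) t m + ∑ n, a (u t x) m n * deriv (fun y => u t y) x n
      = σ * g (u t x) m
  initial : ∀ x, u 0 x = u0 x

end

/-!
The proof follows the compression of a single wave along its characteristics.

Write `u_x = ∑ w_i r_i(u)` with the waves `w_i = l_i(u) u_x` (`wave`). Each wave satisfies a
transport equation `∂_t w_i + ∂_x (λ_i(u) w_i) = G_i` in conservation form. The second derivatives
cancel in `G_i`, and apart from terms of size `O(εκ) ∑ |w_j|` coming from the reaction `εκ g`, the
source is an antisymmetric bilinear expression in `u_t` and `u_x` (`IsSmallStrip.source_eq`). Hence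
it contains only products `w_j w_k` with `j ≠ k`, with no self-interactions
(`IsSmallStrip.abs_source_le`).

The initial datum is a pure `p`-wave: `w_p = ε α'` and `w_k = 0` for `k ≠ p`. The speeds of
different families are separated, so the Glimm interaction potential bounds the products in `L¹` of
space-time (`IsTransport.integral_interaction_le`), and for small total variation the quadratic
terms are absorbed (`integral_abs_source_le`). Up to times of order `1 / ε` all sources together
have mass `O(κε)`, the `p`-wave has mass `O(ε)` and the other waves have mass `O(κε)`; a continuity
argument (`forall_lt_of_bootstrap`) makes these bounds unconditional. The solution keeps a compact
support, by a weighted energy estimate in the eigenbasis at the equilibrium `0`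
(`IsEigenframe.eq_zero_of_lt_abs`), so it is bounded by its total variation and stays in the ball
where the eigenframe is defined.

Choose `y₁ < y₂` with `α(y₂) - α(y₁) ≥ (M / 2) (y₂ - y₁)`, where `M = max α'`, and follow the two
`p`-characteristics starting at `y₁` and `y₂`. The mass of `p`-waves between them is
`ε (α(y₂) - α(y₁)) + O(κε)` up to times of order `1 / ε`. Their relative speed is the integral of
`∂_x λ_p(u) = -γ w_p + …` over the tube, where `γ = -⟨Dλ_p(0), r_p(0)⟩ = γ_ppp(0)`
(`IsEigenframe.gammaDiag_eq`), up to `O(ε² + κε)`. So the width shrinks at least at the rate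
`(γ M ε / 2) (y₂ - y₁)` up to small errors, and would vanish before the time `3 / (γ M ε)`, which
equals three quarters of `4 / (γ M)` divided by `ε`. As characteristics of a `C²` solution never
meet (`characteristics_lt`), the solution cannot exist that long (`IsSmallStrip.lt_width`).
-/

noncomputable section

open MeasureTheory intervalIntegral
open scoped NNReal

/-! ### Limits and differentiation under the integral sign -/

theorem le_of_forall_pos_le_add_mul {A B C : ℝ} (h : ∀ η : ℝ, 0 < η → A ≤ B + C * η) : A ≤ B := by
  have h1 : Filter.Tendsto (fun η : ℝ => B + C * η) (nhdsWithin 0 (Ioi 0)) (nhds (B + C * 0)) :=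
    (Continuous.tendsto (by fun_prop) 0).mono_left nhdsWithin_le_nhds
  have := ge_of_tendsto h1 (by filter_upwards [self_mem_nhdsWithin] with η hη using h η hη)
  simpa using this

theorem hasDerivAt_intervalIntegral_of_continuous {τ : ℝ} {f ft : ℝ → ℝ → ℝ}
    (hf : Continuous fun q : ℝ × ℝ => f q.1 q.2) (hft : Continuous fun q : ℝ × ℝ => ft q.1 q.2)
    (hd : ∀ t ∈ Ioo 0 τ, ∀ x, HasDerivAt (fun s => f s x) (ft t x) t) (a b : ℝ)
    {t : ℝ} (ht : t ∈ Ioo 0 τ) :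
    HasDerivAt (fun s => ∫ y in a..b, f s y) (∫ y in a..b, ft t y) t := by
  have hK : IsCompact (Icc 0 τ ×ˢ uIcc a b) := isCompact_Icc.prod isCompact_uIcc
  obtain ⟨C, hC⟩ := hK.exists_bound_of_continuousOn hft.continuousOn
  refine (intervalIntegral.hasDerivAt_integral_of_dominated_loc_of_deriv_le (s := Ioo 0 τ)
    (bound := fun _ => C) (Ioo_mem_nhds ht.1 ht.2) ?_ ?_ ?_ ?_ ?_ ?_).2
  · exact Filter.Eventually.of_forall fun s => Continuous.aestronglyMeasurable (by fun_prop)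
  · exact Continuous.intervalIntegrable (by fun_prop) _ _
  · exact Continuous.aestronglyMeasurable (by fun_prop)
  · exact Filter.Eventually.of_forall fun y hy s hs =>
      hC (s, y) ⟨Ioo_subset_Icc_self hs, uIoc_subset_uIcc hy⟩
  · exact continuous_const.intervalIntegrable _ _
  · exact Filter.Eventually.of_forall fun y _ s hs => hd s hs y

/-! ### Scalar transport equations in conservation form -/

/-- A scalar `w` on `[0, τ] × ℝ` supported in `|x| ≤ R`, carried by the speed `c`. The functions
`wt`, `wx`, `cx` are the derivatives `∂_t w`, `∂_x w`, `∂_x c`; they are part of the data because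
the derivatives are required only at interior times, while continuity is required for all `(t, x)`,
so that every integral in `t` and `x` has a continuous integrand. -/
structure IsTransport (τ R : ℝ) (w wt wx c cx : ℝ → ℝ → ℝ) : Prop where
  cont : Continuous fun q : ℝ × ℝ => w q.1 q.2
  cont_t : Continuous fun q : ℝ × ℝ => wt q.1 q.2
  cont_x : Continuous fun q : ℝ × ℝ => wx q.1 q.2
  cont_speed : Continuous fun q : ℝ × ℝ => c q.1 q.2
  cont_speed_x : Continuous fun q : ℝ × ℝ => cx q.1 q.2
  deriv_t : ∀ t ∈ Ioo 0 τ, ∀ x, HasDerivAt (fun s => w s x) (wt t x) t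
  deriv_x : ∀ t ∈ Ioo 0 τ, ∀ x, HasDerivAt (w t) (wx t x) x
  deriv_speed : ∀ t ∈ Ioo 0 τ, ∀ x, HasDerivAt (c t) (cx t x) x
  supp : ∀ t x, R ≤ |x| → w t x = 0
  radius_pos : 0 < R

/-- The right-hand side `∂_t w + ∂_x (c w)` of the transport equation in conservation form, with
`∂_x (c w)` expanded by the product rule. -/
def transportSource (w wt wx c cx : ℝ → ℝ → ℝ) (t x : ℝ) : ℝ :=
  wt t x + (cx t x * w t x + c t x * wx t x)

/-! ### Smooth regularization of the absolute value -/

/-- The regularization `√(w² + η²) - η` of the absolute value: smooth for `η ≠ 0`, vanishing at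
`0`, and within `η` of `|w|`. -/
def smoothAbs (η w : ℝ) : ℝ := √(w ^ 2 + η ^ 2) - η

/-- The derivative `w / √(w² + η²)` of `smoothAbs η`, a regularization of the sign of `w`. -/
def smoothSign (η w : ℝ) : ℝ := w / √(w ^ 2 + η ^ 2)

theorem hasDerivAt_smoothAbs {η : ℝ} (hη : 0 < η) (w : ℝ) :
    HasDerivAt (smoothAbs η) (smoothSign η w) w := by
  have h0 : w ^ 2 + η ^ 2 ≠ 0 := by positivity
  have h1 : HasDerivAt (fun w : ℝ => w ^ 2 + η ^ 2) (2 * w) w := by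
    simpa using (hasDerivAt_pow 2 w).add_const (η ^ 2)
  have h2 := (h1.sqrt h0).sub_const η
  have e : smoothSign η w = 2 * w / (2 * √(w ^ 2 + η ^ 2)) := by
    rw [smoothSign, mul_div_mul_left _ _ two_ne_zero]
  rw [e]
  exact h2

theorem continuous_smoothAbs (η : ℝ) : Continuous (smoothAbs η) := by
  unfold smoothAbs; fun_prop

theorem continuous_smoothSign {η : ℝ} (hη : 0 < η) : Continuous (smoothSign η) := by
  unfold smoothSign
  refine continuous_id.div (by fun_prop) fun w => ?_
  have : 0 < w ^ 2 + η ^ 2 := by positivity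
  positivity

theorem smoothAbs_zero {η : ℝ} (hη : 0 < η) : smoothAbs η 0 = 0 := by
  simp [smoothAbs, Real.sqrt_sq hη.le]

theorem smoothAbs_nonneg (η w : ℝ) : 0 ≤ smoothAbs η w := by
  have : η ≤ √(w ^ 2 + η ^ 2) := Real.le_sqrt_of_sq_le (by nlinarith [sq_nonneg w])
  unfold smoothAbs; linarith

theorem smoothAbs_le {η : ℝ} (hη : 0 < η) (w : ℝ) : smoothAbs η w ≤ |w| := by
  have : √(w ^ 2 + η ^ 2) ≤ |w| + η := by
    rw [Real.sqrt_le_left (by positivity)]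
    nlinarith [abs_nonneg w, sq_abs w]
  unfold smoothAbs; linarith

theorem le_smoothAbs_add (η : ℝ) (w : ℝ) : |w| ≤ smoothAbs η w + η := by
  have : |w| ≤ √(w ^ 2 + η ^ 2) := Real.abs_le_sqrt (by nlinarith [sq_nonneg η])
  unfold smoothAbs; linarith

theorem abs_smoothSign_le (η : ℝ) (w : ℝ) : |smoothSign η w| ≤ 1 := by
  have h : |w| ≤ √(w ^ 2 + η ^ 2) := Real.abs_le_sqrt (by nlinarith [sq_nonneg η])
  rw [smoothSign, abs_div, abs_of_nonneg (Real.sqrt_nonneg _)]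
  exact div_le_one_of_le₀ h (Real.sqrt_nonneg _)

/-- `smoothAbs η` fails to be homogeneous of degree one by at most `η`. This defect is the price of
renormalizing a conservation law, see `IsTransport.abs_source_smoothAbs_le`. -/
theorem abs_smoothAbs_sub_smoothSign_mul_le {η : ℝ} (hη : 0 < η) (w : ℝ) :
    |smoothAbs η w - smoothSign η w * w| ≤ η := by
  have hp : 0 < w ^ 2 + η ^ 2 := by positivity
  have hs : 0 < √(w ^ 2 + η ^ 2) := Real.sqrt_pos.2 hp
  have h1 : smoothAbs η w - smoothSign η w * w = η ^ 2 / √(w ^ 2 + η ^ 2) - η := by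
    unfold smoothAbs smoothSign
    have := Real.mul_self_sqrt hp.le
    field_simp
    nlinarith
  have h2 : η ≤ √(w ^ 2 + η ^ 2) := Real.le_sqrt_of_sq_le (by nlinarith [sq_nonneg w])
  have h3 : η ^ 2 / √(w ^ 2 + η ^ 2) ≤ η := by
    rw [div_le_iff₀ hs]; nlinarith
  have h4 : 0 ≤ η ^ 2 / √(w ^ 2 + η ^ 2) := by positivity
  rw [h1, abs_le]; constructor <;> linarith

/-! ### Renormalization and mass balance -/

namespace IsTransport

variable {τ R : ℝ} {w wt wx c cx z zt zx d dx : ℝ → ℝ → ℝ}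

theorem continuous_source (h : IsTransport τ R w wt wx c cx) :
    Continuous fun q : ℝ × ℝ => transportSource w wt wx c cx q.1 q.2 := by
  have := h.cont; have := h.cont_t; have := h.cont_x; have := h.cont_speed
  have := h.cont_speed_x
  unfold transportSource; fun_prop

/-- Renormalization: `smoothAbs η w` is transported with the same speed as `w`. -/
theorem comp_smoothAbs (h : IsTransport τ R w wt wx c cx) {η : ℝ} (hη : 0 < η) :
    IsTransport τ R (fun t x => smoothAbs η (w t x)) (fun t x => smoothSign η (w t x) * wt t x)
      (fun t x => smoothSign η (w t x) * wx t x) c cx where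
  cont := (continuous_smoothAbs η).comp h.cont
  cont_t := ((continuous_smoothSign hη).comp h.cont).mul h.cont_t
  cont_x := ((continuous_smoothSign hη).comp h.cont).mul h.cont_x
  cont_speed := h.cont_speed
  cont_speed_x := h.cont_speed_x
  deriv_t t ht x := HasDerivAt.comp (h₂ := smoothAbs η) (h := fun s => w s x) t
    (hasDerivAt_smoothAbs hη (w t x)) (h.deriv_t t ht x)
  deriv_x t ht x := HasDerivAt.comp x (hasDerivAt_smoothAbs hη (w t x)) (h.deriv_x t ht x)
  deriv_speed := h.deriv_speed
  supp t x hx := by rw [h.supp t x hx, smoothAbs_zero hη]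
  radius_pos := h.radius_pos

theorem abs_source_smoothAbs_le (w wt wx c cx : ℝ → ℝ → ℝ) {η : ℝ} (hη : 0 < η) (t x : ℝ) :
    |transportSource (fun t x => smoothAbs η (w t x))
      (fun t x => smoothSign η (w t x) * wt t x)
      (fun t x => smoothSign η (w t x) * wx t x) c cx t x| ≤
      |transportSource w wt wx c cx t x| + η * |cx t x| := by
  have e : transportSource (fun t x => smoothAbs η (w t x))
      (fun t x => smoothSign η (w t x) * wt t x)
      (fun t x => smoothSign η (w t x) * wx t x) c cx t x =
      smoothSign η (w t x) * transportSource w wt wx c cx t x +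
      cx t x * (smoothAbs η (w t x) - smoothSign η (w t x) * w t x) := by
    unfold transportSource; ring
  rw [e]
  refine (abs_add_le _ _).trans (add_le_add ?_ ?_)
  · rw [abs_mul]
    exact mul_le_of_le_one_left (abs_nonneg _) (abs_smoothSign_le η _)
  · rw [abs_mul, mul_comm η]
    exact mul_le_mul_of_nonneg_left (abs_smoothAbs_sub_smoothSign_mul_le hη _) (abs_nonneg _)

theorem integral_deriv_t (h : IsTransport τ R w wt wx c cx) {t : ℝ} (ht : t ∈ Ioo 0 τ) (x : ℝ) :
    ∫ y in (-R)..x, wt t y =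
      (∫ y in (-R)..x, transportSource w wt wx c cx t y) - c t x * w t x := by
  have h1 := h.cont; have h2 := h.cont_t; have h3 := h.cont_x; have h4 := h.cont_speed
  have h5 := h.cont_speed_x
  have e : ∫ y in (-R)..x, (cx t y * w t y + c t y * wx t y) =
      c t x * w t x - c t (-R) * w t (-R) := by
    refine integral_eq_sub_of_hasDerivAt (f := fun y => c t y * w t y)
      (fun y _ => (h.deriv_speed t ht y).mul (h.deriv_x t ht y))
      (Continuous.intervalIntegrable (by fun_prop) _ _)
  have hs : w t (-R) = 0 := h.supp t (-R) (by rw [abs_neg]; exact le_abs_self R)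
  unfold transportSource
  rw [integral_add (Continuous.intervalIntegrable (by fun_prop) _ _)
    (Continuous.intervalIntegrable (by fun_prop) _ _), e, hs]
  ring

theorem hasDerivAt_primitive (h : IsTransport τ R w wt wx c cx) {t : ℝ} (ht : t ∈ Ioo 0 τ) (x : ℝ) :
    HasDerivAt (fun s => ∫ y in (-R)..x, w s y)
      ((∫ y in (-R)..x, transportSource w wt wx c cx t y) - c t x * w t x) t := by
  rw [← h.integral_deriv_t ht x]
  exact hasDerivAt_intervalIntegral_of_continuous h.cont h.cont_t h.deriv_t _ _ ht

theorem mass_sub (h : IsTransport τ R w wt wx c cx) {t : ℝ} (ht : t ∈ Icc 0 τ) :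
    (∫ x in (-R)..R, w t x) - ∫ x in (-R)..R, w 0 x =
      ∫ s in 0..t, ∫ x in (-R)..R, transportSource w wt wx c cx s x := by
  have h1 := h.cont; have h2 := h.continuous_source
  refine (integral_eq_sub_of_hasDerivAt_of_le ht.1
    (f := fun s => ∫ x in (-R)..R, w s x) ?_ ?_ ?_).symm
  · exact Continuous.continuousOn (by fun_prop)
  · intro s hs
    have := h.hasDerivAt_primitive (t := s) ⟨hs.1, hs.2.trans_le ht.2⟩ R
    rwa [h.supp s R (le_abs_self R), mul_zero, sub_zero] at this
  · exact Continuous.intervalIntegrable (by fun_prop) _ _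

end IsTransport

/-! ### Growth of the mass and the interaction potential -/

namespace IsTransport

variable {τ R : ℝ} {w wt wx c cx z zt zx d dx : ℝ → ℝ → ℝ}

/-- The `L¹` norm grows at most by the total mass of the source. Since `|w|` is not differentiable,
the mass balance is applied to `smoothAbs η w` and `η` tends to `0`. -/
theorem integral_abs_le (h : IsTransport τ R w wt wx c cx) {t : ℝ} (ht : t ∈ Icc 0 τ) :
    ∫ x in (-R)..R, |w t x| ≤ (∫ x in (-R)..R, |w 0 x|) +
      ∫ s in 0..t, ∫ x in (-R)..R, |transportSource w wt wx c cx s x| := by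
  have h1 := h.cont; have h2 := h.continuous_source; have h3 := h.cont_speed_x
  have hR : -R ≤ R := by linarith [h.radius_pos]
  refine le_of_forall_pos_le_add_mul
    (C := 2 * R + ∫ s in 0..t, ∫ x in (-R)..R, |cx s x|) fun η hη => ?_
  have hφ := h.comp_smoothAbs hη
  have h0 := continuous_smoothAbs η
  have h4 := hφ.cont
  have h5 := hφ.continuous_source
  have hm := hφ.mass_sub ht
  have e1 : ∫ x in (-R)..R, |w t x| ≤ ∫ x in (-R)..R, (smoothAbs η (w t x) + η) :=
    integral_mono_on hR (Continuous.intervalIntegrable (by fun_prop) _ _)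
      (Continuous.intervalIntegrable (by fun_prop) _ _) fun x _ => le_smoothAbs_add η _
  have e2 : ∫ x in (-R)..R, smoothAbs η (w 0 x) ≤ ∫ x in (-R)..R, |w 0 x| :=
    integral_mono_on hR (Continuous.intervalIntegrable (by fun_prop) _ _)
      (Continuous.intervalIntegrable (by fun_prop) _ _) fun x _ => smoothAbs_le hη _
  have e3 : ∫ s in 0..t, ∫ x in (-R)..R, transportSource (fun t x => smoothAbs η (w t x))
        (fun t x => smoothSign η (w t x) * wt t x)
        (fun t x => smoothSign η (w t x) * wx t x) c cx s x ≤
      ∫ s in 0..t, ∫ x in (-R)..R, (|transportSource w wt wx c cx s x| + η * |cx s x|) := by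
    refine integral_mono_on ht.1 (Continuous.intervalIntegrable (by fun_prop) _ _)
      (Continuous.intervalIntegrable (by fun_prop) _ _) fun s _ => ?_
    refine integral_mono_on hR (Continuous.intervalIntegrable (by fun_prop) _ _)
      (Continuous.intervalIntegrable (by fun_prop) _ _) fun x _ => ?_
    exact (le_abs_self _).trans (abs_source_smoothAbs_le w wt wx c cx hη s x)
  have e4 : ∫ s in 0..t, ∫ x in (-R)..R, (|transportSource w wt wx c cx s x| + η * |cx s x|) =
      (∫ s in 0..t, ∫ x in (-R)..R, |transportSource w wt wx c cx s x|) +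
      η * ∫ s in 0..t, ∫ x in (-R)..R, |cx s x| := by
    rw [← intervalIntegral.integral_const_mul, ← integral_add
      (Continuous.intervalIntegrable (by fun_prop) _ _)
      (Continuous.intervalIntegrable (by fun_prop) _ _)]
    congr 1; ext s
    rw [← intervalIntegral.integral_const_mul, ← integral_add
      (Continuous.intervalIntegrable (by fun_prop) _ _)
      (Continuous.intervalIntegrable (by fun_prop) _ _)]
  rw [integral_add (Continuous.intervalIntegrable (by fun_prop) _ _)
      (Continuous.intervalIntegrable (by fun_prop) _ _), intervalIntegral.integral_const,
      smul_eq_mul] at e1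
  nlinarith

/-- The product of the primitive of one transported scalar with a second one is again transported,
with the speed of the second. Its mass is the Glimm interaction potential
`∬_{y < x} w(t, y) z(t, x) dy dx`. -/
theorem primitive_mul (h : IsTransport τ R w wt wx c cx) (k : IsTransport τ R z zt zx d dx) :
    IsTransport τ R (fun t x => (∫ y in (-R)..x, w t y) * z t x)
      (fun t x => ((∫ y in (-R)..x, transportSource w wt wx c cx t y) - c t x * w t x) * z t x +
        (∫ y in (-R)..x, w t y) * zt t x)
      (fun t x => w t x * z t x + (∫ y in (-R)..x, w t y) * zx t x) d dx := by
  have h1 := h.cont; have h2 := h.continuous_source; have h3 := h.cont_speed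
  have k1 := k.cont; have k2 := k.cont_t; have k3 := k.cont_x
  have hP : Continuous fun q : ℝ × ℝ => ∫ y in (-R)..q.2, w q.1 y :=
    continuous_parametric_primitive_of_continuous (f := w) h1
  have hS : Continuous fun q : ℝ × ℝ => ∫ y in (-R)..q.2, transportSource w wt wx c cx q.1 y :=
    continuous_parametric_primitive_of_continuous (f := transportSource w wt wx c cx) h2
  exact
  { cont := hP.mul k1
    cont_t := ((hS.sub (h3.mul h1)).mul k1).add (hP.mul k2)
    cont_x := (h1.mul k1).add (hP.mul k3)
    cont_speed := k.cont_speed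
    cont_speed_x := k.cont_speed_x
    deriv_t := fun t ht x => (h.hasDerivAt_primitive ht x).mul (k.deriv_t t ht x)
    deriv_x := fun t ht x => by
      have hc : Continuous (w t) := by fun_prop
      exact (integral_hasDerivAt_right (hc.intervalIntegrable _ _)
        (hc.stronglyMeasurableAtFilter _ _) hc.continuousAt).mul (k.deriv_x t ht x)
    deriv_speed := k.deriv_speed
    supp := fun t x hx => by rw [k.supp t x hx, mul_zero]
    radius_pos := k.radius_pos }

/-- The interaction potential loses `(c - d) w z` per unit of time: the term that makes it useful.
-/
theorem source_primitive_mul (R : ℝ) (w wt wx c cx z zt zx d dx : ℝ → ℝ → ℝ) (t x : ℝ) :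
    transportSource (fun t x => (∫ y in (-R)..x, w t y) * z t x)
      (fun t x => ((∫ y in (-R)..x, transportSource w wt wx c cx t y) - c t x * w t x) * z t x +
        (∫ y in (-R)..x, w t y) * zt t x)
      (fun t x => w t x * z t x + (∫ y in (-R)..x, w t y) * zx t x) d dx t x =
      (∫ y in (-R)..x, transportSource w wt wx c cx t y) * z t x +
      (∫ y in (-R)..x, w t y) * transportSource z zt zx d dx t x -
      (c t x - d t x) * (w t x * z t x) := by
  unfold transportSource; ring

theorem abs_primitive_le {R : ℝ} {f g : ℝ → ℝ} (hf : Continuous f) (hg : Continuous g)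
    (hfg : ∀ x, |f x| ≤ g x) {x : ℝ} (hx : x ∈ Icc (-R) R) :
    |∫ y in (-R)..x, f y| ≤ ∫ y in (-R)..R, g y := by
  calc |∫ y in (-R)..x, f y| ≤ ∫ y in (-R)..x, |f y| := abs_integral_le_integral_abs hx.1
    _ ≤ ∫ y in (-R)..x, g y := integral_mono_on hx.1 (hf.abs.intervalIntegrable _ _)
        (hg.intervalIntegrable _ _) fun y _ => hfg y
    _ ≤ ∫ y in (-R)..R, g y := integral_mono_interval le_rfl hx.1 hx.2
        (Filter.Eventually.of_forall fun y => (abs_nonneg _).trans (hfg y))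
        (hg.intervalIntegrable _ _)

/-- Glimm's estimate. If `w` moves faster than `z` by at least `m`, then the waves of `w` that
start out to the left of those of `z` overtake them only once, so the interaction `∬ |w| |z|` is
controlled by the masses and by the sources. The hypothesis `h0` says that `w` and `z` do not
interact initially, because one of them vanishes. -/
theorem integral_interaction_le (h : IsTransport τ R w wt wx c cx)
    (k : IsTransport τ R z zt zx d dx) {A m : ℝ} (hm : 0 ≤ m)
    (hgap : ∀ t x, m ≤ c t x - d t x) (h0 : ∀ x y, w 0 x * z 0 y = 0)
    {t : ℝ} (ht : t ∈ Icc 0 τ)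
    (hw : ∀ s ∈ Icc 0 t, ∫ x in (-R)..R, |w s x| ≤ A)
    (hz : ∀ s ∈ Icc 0 t, ∫ x in (-R)..R, |z s x| ≤ A) :
    m * ∫ s in 0..t, ∫ x in (-R)..R, |w s x| * |z s x| ≤
      A * ((∫ s in 0..t, ∫ x in (-R)..R, |transportSource w wt wx c cx s x|) +
        ∫ s in 0..t, ∫ x in (-R)..R, |transportSource z zt zx d dx s x|) := by
  have h1 := h.cont; have h2 := h.continuous_source; have h3 := h.cont_speed_x
  have k1 := k.cont; have k2 := k.continuous_source; have k3 := k.cont_speed_x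
  have hR : -R ≤ R := by linarith [h.radius_pos]
  refine le_of_forall_pos_le_add_mul
    (C := A * ((∫ s in 0..t, ∫ x in (-R)..R, |cx s x|) + ∫ s in 0..t, ∫ x in (-R)..R, |dx s x|) +
      m * ∫ s in 0..t, ∫ x in (-R)..R, (|w s x| + |z s x|)) fun η hη => ?_
  have hφ := h.comp_smoothAbs hη
  have kφ := k.comp_smoothAbs hη
  set ρ : ℝ → ℝ → ℝ := fun t x => smoothAbs η (w t x) with hρ
  set ζ : ℝ → ℝ → ℝ := fun t x => smoothAbs η (z t x) with hζ
  set S : ℝ → ℝ → ℝ := transportSource ρ (fun t x => smoothSign η (w t x) * wt t x)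
        (fun t x => smoothSign η (w t x) * wx t x) c cx with hS
  set S' : ℝ → ℝ → ℝ := transportSource ζ (fun t x => smoothSign η (z t x) * zt t x)
        (fun t x => smoothSign η (z t x) * zx t x) d dx with hS'
  have cρ := hφ.cont; have cS := hφ.continuous_source
  have cζ := kφ.cont; have cS' := kφ.continuous_source
  have hP := hφ.primitive_mul kφ
  have cG := hP.continuous_source
  have hmass := hP.mass_sub ht
  simp only [source_primitive_mul] at hmass cG
  rw [← hS, ← hS'] at hmass cG
  have hρ0 : ∀ t x, 0 ≤ ρ t x := fun t x => smoothAbs_nonneg η _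
  have hζ0 : ∀ t x, 0 ≤ ζ t x := fun t x => smoothAbs_nonneg η _
  -- The interaction potential is nonnegative at time `t` and vanishes at time `0`.
  have hfin : 0 ≤ ∫ x in (-R)..R, (∫ y in (-R)..x, ρ t y) * ζ t x :=
    integral_nonneg hR fun x hx =>
      mul_nonneg (integral_nonneg hx.1 fun y _ => hρ0 t y) (hζ0 t x)
  have hini : ∫ x in (-R)..R, (∫ y in (-R)..x, ρ 0 y) * ζ 0 x = 0 := by
    have : ∀ x, (∫ y in (-R)..x, ρ 0 y) * ζ 0 x = 0 := fun x => by
      rw [← intervalIntegral.integral_mul_const]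
      have : ∀ y, ρ 0 y * ζ 0 x = 0 := fun y => by
        rcases mul_eq_zero.1 (h0 y x) with e | e
        · simp only [hρ, e, smoothAbs_zero hη, zero_mul]
        · simp only [hζ, e, smoothAbs_zero hη, mul_zero]
      simp [this]
    simp [this]
  rw [hini, sub_zero] at hmass
  rw [hmass] at hfin
  set a : ℝ → ℝ := fun s => ∫ x in (-R)..R, (|transportSource w wt wx c cx s x| + η * |cx s x|)
    with ha
  set b : ℝ → ℝ := fun s => ∫ x in (-R)..R, (|transportSource z zt zx d dx s x| + η * |dx s x|)
    with hb
  have ca : Continuous a := by fun_prop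
  have cb : Continuous b := by fun_prop
  have key : ∀ s ∈ Icc 0 t, ∫ x in (-R)..R, ((∫ y in (-R)..x, S s y) * ζ s x +
      (∫ y in (-R)..x, ρ s y) * S' s x - (c s x - d s x) * (ρ s x * ζ s x)) ≤
      A * a s + A * b s - m * ∫ x in (-R)..R, ρ s x * ζ s x := by
    intro s hs
    have hA : 0 ≤ a s := integral_nonneg hR fun x _ => by positivity
    have hAA : 0 ≤ A := (integral_nonneg hR fun x _ => abs_nonneg _).trans (hw s hs)
    have b1 : ∀ x ∈ Icc (-R) R, |∫ y in (-R)..x, S s y| ≤ a s := fun x hx =>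
      abs_primitive_le (by fun_prop) (by fun_prop)
        (fun y => abs_source_smoothAbs_le w wt wx c cx hη s y) hx
    have b2 : ∀ x ∈ Icc (-R) R, |∫ y in (-R)..x, ρ s y| ≤ A := fun x hx =>
      (abs_primitive_le (by fun_prop) (g := fun y => |w s y|) (by fun_prop)
        (fun y => by rw [abs_of_nonneg (hρ0 s y)]; exact smoothAbs_le hη _) hx).trans (hw s hs)
    calc _ ≤ ∫ x in (-R)..R, (a s * |z s x| +
          A * (|transportSource z zt zx d dx s x| + η * |dx s x|) - m * (ρ s x * ζ s x)) := by
          refine integral_mono_on hR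
            ((cG.comp (by fun_prop : Continuous fun x : ℝ => (s, x))).intervalIntegrable _ _)
            (Continuous.intervalIntegrable (by fun_prop) _ _) fun x hx => ?_
          refine sub_le_sub (add_le_add ?_ ?_)
            (mul_le_mul_of_nonneg_right (hgap s x) (mul_nonneg (hρ0 s x) (hζ0 s x)))
          · exact mul_le_mul ((le_abs_self _).trans (b1 x hx)) (smoothAbs_le hη _) (hζ0 s x) hA
          · refine (le_abs_self _).trans ?_
            rw [abs_mul]
            exact mul_le_mul (b2 x hx) (abs_source_smoothAbs_le z zt zx d dx hη s x)
              (abs_nonneg _) hAA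
      _ = a s * (∫ x in (-R)..R, |z s x|) + A * b s - m * ∫ x in (-R)..R, ρ s x * ζ s x := by
          rw [integral_sub (Continuous.intervalIntegrable (by fun_prop) _ _)
            (Continuous.intervalIntegrable (by fun_prop) _ _),
            integral_add (Continuous.intervalIntegrable (by fun_prop) _ _)
            (Continuous.intervalIntegrable (by fun_prop) _ _)]
          simp only [intervalIntegral.integral_const_mul, hb]
      _ ≤ _ := by
          have := mul_le_mul_of_nonneg_left (hz s hs) hA
          linarith
  have cG' : Continuous fun s => ∫ x in (-R)..R, ((∫ y in (-R)..x, S s y) * ζ s x +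
      (∫ y in (-R)..x, ρ s y) * S' s x - (c s x - d s x) * (ρ s x * ζ s x)) := by
    exact continuous_parametric_intervalIntegral_of_continuous' (μ := volume) cG _ _
  have hle := integral_mono_on (μ := volume) ht.1 (cG'.intervalIntegrable _ _)
    (Continuous.intervalIntegrable (by fun_prop) _ _) key
  have hsplit : ∫ s in 0..t, (A * a s + A * b s - m * ∫ x in (-R)..R, ρ s x * ζ s x) =
      A * (∫ s in 0..t, a s) + A * (∫ s in 0..t, b s) -
        m * ∫ s in 0..t, ∫ x in (-R)..R, ρ s x * ζ s x := by
    rw [integral_sub (Continuous.intervalIntegrable (by fun_prop) _ _)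
      (Continuous.intervalIntegrable (by fun_prop) _ _),
      integral_add (Continuous.intervalIntegrable (by fun_prop) _ _)
      (Continuous.intervalIntegrable (by fun_prop) _ _)]
    simp only [intervalIntegral.integral_const_mul]
  have hdouble : ∀ f g : ℝ → ℝ → ℝ, (Continuous fun q : ℝ × ℝ => f q.1 q.2) →
      (Continuous fun q : ℝ × ℝ => g q.1 q.2) →
      ∫ s in 0..t, ∫ x in (-R)..R, (f s x + η * g s x) =
      (∫ s in 0..t, ∫ x in (-R)..R, f s x) + η * ∫ s in 0..t, ∫ x in (-R)..R, g s x := by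
    intro f g hf hg
    rw [← intervalIntegral.integral_const_mul, ← integral_add
      (Continuous.intervalIntegrable (by fun_prop) _ _)
      (Continuous.intervalIntegrable (by fun_prop) _ _)]
    congr 1; ext s
    rw [← intervalIntegral.integral_const_mul, ← integral_add
      (Continuous.intervalIntegrable (by fun_prop) _ _)
      (Continuous.intervalIntegrable (by fun_prop) _ _)]
  have ea := hdouble (fun s x => |transportSource w wt wx c cx s x|) (fun s x => |cx s x|)
    (by fun_prop) (by fun_prop)
  have eb := hdouble (fun s x => |transportSource z zt zx d dx s x|) (fun s x => |dx s x|)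
    (by fun_prop) (by fun_prop)
  have ec := hdouble (fun s x => ρ s x * ζ s x) (fun s x => |w s x| + |z s x|)
    (by fun_prop) (by fun_prop)
  -- Back from the regularized scalars to `|w| |z|`, at the cost of a multiple of `η`.
  have hwz : ∫ s in 0..t, ∫ x in (-R)..R, |w s x| * |z s x| ≤
      ∫ s in 0..t, ∫ x in (-R)..R, (ρ s x * ζ s x + η * (|w s x| + |z s x|)) := by
    refine integral_mono_on ht.1 (Continuous.intervalIntegrable (by fun_prop) _ _)
      (Continuous.intervalIntegrable (by fun_prop) _ _) fun s _ => ?_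
    refine integral_mono_on hR (Continuous.intervalIntegrable (by fun_prop) _ _)
      (Continuous.intervalIntegrable (by fun_prop) _ _) fun x _ => ?_
    have i1 := le_smoothAbs_add η (w s x)
    have i2 := le_smoothAbs_add η (z s x)
    have i3 : ρ s x ≤ |w s x| := smoothAbs_le hη _
    change |w s x| ≤ ρ s x + η at i1
    change |z s x| ≤ ζ s x + η at i2
    have := mul_le_mul_of_nonneg_right i1 (abs_nonneg (z s x))
    have := mul_le_mul_of_nonneg_left i2 (hρ0 s x)
    nlinarith
  have hwz' := mul_le_mul_of_nonneg_left hwz hm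
  simp only [ha, hb] at hsplit
  rw [hsplit, ea, eb] at hle
  rw [ec] at hwz'
  linarith

end IsTransport

/-! ### Systems of transport equations with transversal interactions -/

/-- The sum `∑_{j ≠ k} |v_j| |v_k|` of the products of distinct components. -/
def crossSum {ι : Type*} [Fintype ι] [DecidableEq ι] (v : ι → ℝ) : ℝ :=
  ∑ j, ∑ k, if j = k then 0 else |v j| * |v k|

section
variable {ι : Type*} [Fintype ι] [DecidableEq ι]

theorem integral_integral_finset_sum {κ : Type*} (s : Finset κ) {f : κ → ℝ → ℝ → ℝ}
    (hf : ∀ i ∈ s, Continuous fun q : ℝ × ℝ => f i q.1 q.2) (a b a' b' : ℝ) :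
    ∫ t in a..b, ∫ x in a'..b', ∑ i ∈ s, f i t x =
      ∑ i ∈ s, ∫ t in a..b, ∫ x in a'..b', f i t x := by
  rw [← intervalIntegral.integral_finsetSum]
  · congr 1; ext t
    refine intervalIntegral.integral_finsetSum fun i hi => ?_
    have := hf i hi
    exact Continuous.intervalIntegrable (by fun_prop) _ _
  · intro i hi
    have := hf i hi
    exact Continuous.intervalIntegrable (by fun_prop) _ _

/-- For a family of transported scalars with separated speeds, of which only one is nonzero
initially, and whose sources are bounded by products of *distinct* components plus a linear term of
size `b`, the sources have total mass `O(b t)`: if the `L¹` norms are small, the interaction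
estimate absorbs the quadratic terms. -/
theorem integral_abs_source_le {τ R : ℝ} {w wt wx c cx : ι → ℝ → ℝ → ℝ}
    (h : ∀ i, IsTransport τ R (w i) (wt i) (wx i) (c i) (cx i)) {m A B b : ℝ} (hm : 0 < m)
    (hA : 0 ≤ A) (hB : 0 ≤ B) (hb : 0 ≤ b)
    (hgap : ∀ i j, i ≠ j → (∀ t x, m ≤ c i t x - c j t x) ∨ ∀ t x, m ≤ c j t x - c i t x)
    (p : ι) (h0 : ∀ i, i ≠ p → ∀ x, w i 0 x = 0)
    (hG : ∀ i, ∀ t ∈ Ioo 0 τ, ∀ x,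
      |transportSource (w i) (wt i) (wx i) (c i) (cx i) t x| ≤
        B * crossSum (fun j => w j t x) + b * ∑ j, |w j t x|)
    (hw : ∀ i, ∀ s ∈ Icc 0 τ, ∫ x in (-R)..R, |w i s x| ≤ A)
    (hsmall : 4 * (Fintype.card ι : ℝ) ^ 2 * A * B ≤ m) {t : ℝ} (ht : t ∈ Icc 0 τ) (i : ι) :
    ∫ s in 0..t, ∫ x in (-R)..R, |transportSource (w i) (wt i) (wx i) (c i) (cx i) s x| ≤
      2 * Fintype.card ι * A * b * t := by
  have hR : -R ≤ R := by linarith [(h i).radius_pos]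
  have cw : ∀ i, Continuous fun q : ℝ × ℝ => w i q.1 q.2 := fun i => (h i).cont
  have cG : ∀ i, Continuous fun q : ℝ × ℝ =>
    transportSource (w i) (wt i) (wx i) (c i) (cx i) q.1 q.2 := fun i => (h i).continuous_source
  set n : ℝ := (Fintype.card ι : ℝ) with hn
  have hn0 : 0 ≤ n := Nat.cast_nonneg _
  set Γ : ι → ℝ := fun i => ∫ s in 0..t, ∫ x in (-R)..R,
    |transportSource (w i) (wt i) (wx i) (c i) (cx i) s x| with hΓ
  set D : ι → ι → ℝ := fun j k => ∫ s in 0..t, ∫ x in (-R)..R,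
    (if j = k then 0 else |w j s x| * |w k s x|) with hD
  have cD : ∀ j k, Continuous fun q : ℝ × ℝ =>
      (if j = k then 0 else |w j q.1 q.2| * |w k q.1 q.2|) := by
    intro j k
    have := cw j; have := cw k
    split_ifs <;> fun_prop
  -- `Q` names the cross sum, so that it is not unfolded under the integrals.
  obtain ⟨Q, hQ⟩ : ∃ Q : ℝ → ℝ → ℝ, ∀ s x, Q s x = crossSum (fun j => w j s x) :=
    ⟨_, fun _ _ => rfl⟩
  simp only [← hQ] at hG
  have cX : Continuous fun q : ℝ × ℝ => Q q.1 q.2 := by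
    simp only [hQ]
    exact continuous_finsetSum _ fun j _ => continuous_finsetSum _ fun k _ => cD j k
  set X : ℝ := ∫ s in 0..t, ∫ x in (-R)..R, Q s x with hX
  have cS : Continuous fun q : ℝ × ℝ => ∑ j, |w j q.1 q.2| :=
    continuous_finsetSum _ fun j _ => (cw j).abs
  have hXD : X = ∑ j, ∑ k, D j k := by
    simp only [hX, hQ, crossSum]
    rw [integral_integral_finset_sum _
      fun j _ => continuous_finsetSum _ fun k _ => cD j k]
    exact Finset.sum_congr rfl fun j _ => integral_integral_finset_sum _ (fun k _ => cD j k) _ _ _ _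
  have hX0 : 0 ≤ X := integral_nonneg ht.1 fun s _ => integral_nonneg hR fun x _ => by
    rw [hQ]
    exact Finset.sum_nonneg fun j _ => Finset.sum_nonneg fun k _ => by split_ifs <;> positivity
  have hΓle : ∀ i, Γ i ≤ B * X + b * (n * A * t) := by
    intro i
    have e1 : Γ i ≤ ∫ s in 0..t, ∫ x in (-R)..R,
        (B * Q s x + b * ∑ j, |w j s x|) := by
      have := cG i
      refine integral_mono_on_of_le_Ioo ht.1 (Continuous.intervalIntegrable (by fun_prop) _ _)
        (Continuous.intervalIntegrable (by fun_prop) _ _) fun s hs => ?_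
      exact integral_mono_on hR (Continuous.intervalIntegrable (by fun_prop) _ _)
        (Continuous.intervalIntegrable (by fun_prop) _ _)
        fun x _ => hG i s ⟨hs.1, hs.2.trans_le ht.2⟩ x
    have e2 : ∫ s in 0..t, ∫ x in (-R)..R,
        (B * Q s x + b * ∑ j, |w j s x|) =
        B * X + b * ∫ s in 0..t, ∫ x in (-R)..R, ∑ j, |w j s x| := by
      rw [hX, ← intervalIntegral.integral_const_mul, ← intervalIntegral.integral_const_mul,
        ← integral_add (Continuous.intervalIntegrable (by fun_prop) _ _)
        (Continuous.intervalIntegrable (by fun_prop) _ _)]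
      congr 1; ext s
      rw [← intervalIntegral.integral_const_mul, ← intervalIntegral.integral_const_mul,
        ← integral_add (Continuous.intervalIntegrable (by fun_prop) _ _)
        (Continuous.intervalIntegrable (by fun_prop) _ _)]
    have e3 : ∫ s in 0..t, ∫ x in (-R)..R, ∑ j, |w j s x| ≤ n * A * t := by
      have : ∫ s in 0..t, ∫ x in (-R)..R, ∑ j, |w j s x| ≤ ∫ s in 0..t, n * A := by
        refine integral_mono_on ht.1 (Continuous.intervalIntegrable (by fun_prop) _ _)
          (continuous_const.intervalIntegrable _ _) fun s hs => ?_
        rw [intervalIntegral.integral_finsetSum fun j _ => Continuous.intervalIntegrable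
          (by have := cw j; fun_prop) _ _]
        calc ∑ j, ∫ x in (-R)..R, |w j s x| ≤ ∑ _j : ι, A :=
              Finset.sum_le_sum fun j _ => hw j s ⟨hs.1, hs.2.trans ht.2⟩
          _ = n * A := by simp [hn]
      rw [intervalIntegral.integral_const, smul_eq_mul] at this
      linarith
    rw [e2] at e1
    exact e1.trans (by gcongr)
  set Y : ℝ := B * X + b * (n * A * t) with hY
  have hDle : ∀ j k, m * D j k ≤ A * (2 * Y) := by
    intro j k
    by_cases hjk : j = k
    · have hY0 : 0 ≤ Y := by have := ht.1; positivity
      simp only [hD, hjk, if_true, intervalIntegral.integral_zero, mul_zero]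
      positivity
    · have hvan : ∀ x y, w j 0 x * w k 0 y = 0 := fun x y => by
        by_cases hj : j = p
        · rw [h0 k (fun e => hjk (hj.trans e.symm)) y, mul_zero]
        · rw [h0 j hj x, zero_mul]
      have hvan' : ∀ x y, w k 0 x * w j 0 y = 0 := fun x y => by rw [mul_comm, hvan]
      have hs : ∀ i, ∀ s ∈ Icc 0 t, ∫ x in (-R)..R, |w i s x| ≤ A :=
        fun i s hs => hw i s ⟨hs.1, hs.2.trans ht.2⟩
      have hsum : A * (Γ j + Γ k) ≤ A * (2 * Y) :=
        mul_le_mul_of_nonneg_left (by linarith [hΓle j, hΓle k]) hA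
      simp only [hD, if_neg hjk]
      rcases hgap j k hjk with hg | hg
      · exact ((h j).integral_interaction_le (h k) hm.le hg hvan ht (hs j) (hs k)).trans hsum
      · have := (h k).integral_interaction_le (h j) hm.le hg hvan' ht (hs k) (hs j)
        simp only [mul_comm |w k _ _|] at this
        rw [add_comm] at this
        exact this.trans hsum
  have hXle : m * X ≤ n ^ 2 * (A * (2 * Y)) := by
    rw [hXD, Finset.mul_sum]
    calc ∑ j, m * ∑ k, D j k = ∑ j, ∑ k, m * D j k := by simp only [Finset.mul_sum]
      _ ≤ ∑ _j : ι, ∑ _k : ι, A * (2 * Y) :=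
        Finset.sum_le_sum fun j _ => Finset.sum_le_sum fun k _ => hDle j k
      _ = n ^ 2 * (A * (2 * Y)) := by simp [hn]; ring
  have hZ : 0 ≤ b * (n * A * t) := by have := ht.1; positivity
  -- Absorption: `hsmall` turns the interaction bound into `B X ≤ Y / 2`, and `Y = B X + b n A t`.
  have hBX : B * X ≤ b * (n * A * t) := by
    have h1 : B * (m * X) ≤ B * (n ^ 2 * (A * (2 * Y))) := mul_le_mul_of_nonneg_left hXle hB
    have hY0 : 0 ≤ Y := by positivity
    have h2 : 4 * n ^ 2 * A * B * Y ≤ m * Y := mul_le_mul_of_nonneg_right hsmall hY0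
    have h3 : m * (2 * (B * X)) ≤ m * Y := by linarith
    have h4 := le_of_mul_le_mul_left h3 hm
    linarith
  have := hΓle i
  calc Γ i ≤ Y := this
    _ ≤ 2 * n * A * b * t := by linarith

end

/-! ### Functions of class C² on a strip -/

/-- The nearest point of `[0, τ]`. Composing with it extends a function of the time in `[0, τ]`
continuously to all times. -/
def clamp (τ t : ℝ) : ℝ := max 0 (min τ t)

theorem continuous_clamp (τ : ℝ) : Continuous (clamp τ) := by unfold clamp; fun_prop

theorem clamp_mem {τ : ℝ} (hτ : 0 ≤ τ) (t : ℝ) : clamp τ t ∈ Icc 0 τ :=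
  ⟨le_max_left _ _, max_le hτ (min_le_left _ _)⟩

theorem clamp_of_mem {τ t : ℝ} (ht : t ∈ Icc 0 τ) : clamp τ t = t := by
  rw [clamp, min_eq_right ht.2, max_eq_right ht.1]

theorem clamp_eventuallyEq {τ t : ℝ} (ht : t ∈ Ioo 0 τ) : ∀ᶠ s in nhds t, clamp τ s = s := by
  filter_upwards [Ioo_mem_nhds ht.1 ht.2] with s hs using clamp_of_mem (Ioo_subset_Icc_self hs)

/-- `u` together with its first derivatives `ut`, `ux`, the mixed derivative `uxt` and the second
derivative `uxx`. The five functions are continuous on the whole plane; the time derivatives, and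
the second derivatives, are asserted only for `0 < t < τ`. The two clauses on `uxt` state that the
mixed derivatives commute. -/
structure IsC2Strip {E : Type*} [NormedAddCommGroup E] [NormedSpace ℝ E] (τ : ℝ)
    (u ut ux uxt uxx : ℝ → ℝ → E) : Prop where
  cont : Continuous fun q : ℝ × ℝ => u q.1 q.2
  cont_t : Continuous fun q : ℝ × ℝ => ut q.1 q.2
  cont_x : Continuous fun q : ℝ × ℝ => ux q.1 q.2
  cont_xt : Continuous fun q : ℝ × ℝ => uxt q.1 q.2
  cont_xx : Continuous fun q : ℝ × ℝ => uxx q.1 q.2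
  deriv_x : ∀ t x, HasDerivAt (u t) (ux t x) x
  deriv_t : ∀ t ∈ Ioo 0 τ, ∀ x, HasDerivAt (fun s => u s x) (ut t x) t
  deriv_x_x : ∀ t ∈ Ioo 0 τ, ∀ x, HasDerivAt (ux t) (uxx t x) x
  deriv_x_t : ∀ t ∈ Ioo 0 τ, ∀ x, HasDerivAt (fun s => ux s x) (uxt t x) t
  deriv_t_x : ∀ t ∈ Ioo 0 τ, ∀ x, HasDerivAt (ut t) (uxt t x) x

section
variable {E : Type*} [NormedAddCommGroup E] [NormedSpace ℝ E]

/-- Freezing the solution outside a shorter time interval. -/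
theorem IsC2Strip.clamp {T : ℝ} {u ut ux uxt uxx : ℝ → ℝ → E} (h : IsC2Strip T u ut ux uxt uxx)
    {τ : ℝ} (hτ : τ ≤ T) :
    IsC2Strip τ (fun t => u (clamp τ t)) (fun t => ut (clamp τ t)) (fun t => ux (clamp τ t))
      (fun t => uxt (clamp τ t)) (fun t => uxx (clamp τ t)) := by
  have hc : Continuous fun q : ℝ × ℝ => (_root_.clamp τ q.1, q.2) :=
    ((continuous_clamp τ).comp continuous_fst).prodMk continuous_snd
  have hm : ∀ t ∈ Ioo 0 τ, t ∈ Ioo 0 T := fun t ht => ⟨ht.1, ht.2.trans_le hτ⟩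
  have hI : ∀ t ∈ Ioo 0 τ, _root_.clamp τ t = t := fun t ht =>
    clamp_of_mem (Ioo_subset_Icc_self ht)
  exact
  { cont := h.cont.comp hc
    cont_t := h.cont_t.comp hc
    cont_x := h.cont_x.comp hc
    cont_xt := h.cont_xt.comp hc
    cont_xx := h.cont_xx.comp hc
    deriv_x := fun t x => h.deriv_x _ x
    deriv_t := fun t ht x => by
      simp only [hI t ht]
      refine (h.deriv_t t (hm t ht) x).congr_of_eventuallyEq ?_
      filter_upwards [clamp_eventuallyEq ht] with s hs
      rw [hs]
    deriv_x_x := fun t ht x => by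
      simp only [hI t ht]; exact h.deriv_x_x t (hm t ht) x
    deriv_x_t := fun t ht x => by
      simp only [hI t ht]
      refine (h.deriv_x_t t (hm t ht) x).congr_of_eventuallyEq ?_
      filter_upwards [clamp_eventuallyEq ht] with s hs
      rw [hs]
    deriv_t_x := fun t ht x => by
      simp only [hI t ht]; exact h.deriv_t_x t (hm t ht) x }

/-- A `C²` function on the closed strip `[0, T] × ℝ` extends, by clamping the time, to an
`IsC2Strip`. The derivatives of the extension are the derivatives within the strip at the clamped
point. -/
theorem ContDiffOn.exists_isC2Strip {T : ℝ} (hT : 0 < T) {u : ℝ → ℝ → E}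
    (hu : ContDiffOn ℝ 2 (fun q : ℝ × ℝ => u q.1 q.2) (Icc 0 T ×ˢ univ)) :
    ∃ v vt vx vxt vxx : ℝ → ℝ → E, IsC2Strip T v vt vx vxt vxx ∧
      ∀ t x, v t x = u (clamp T t) x := by
  set s : Set (ℝ × ℝ) := Icc 0 T ×ˢ univ with hs
  set F : ℝ × ℝ → E := fun q => u q.1 q.2 with hF
  have hud : UniqueDiffOn ℝ s := (uniqueDiffOn_Icc hT).prod uniqueDiffOn_univ
  set D := fderivWithin ℝ F s with hD
  have hD1 : ContDiffOn ℝ 1 D s := hu.fderivWithin hud (by norm_num)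
  set DD := fderivWithin ℝ D s with hDD
  have hD2 : ContinuousOn DD s := hD1.continuousOn_fderivWithin hud le_rfl
  have hFd : ∀ q ∈ s, HasFDerivWithinAt F (D q) s q := fun q hq =>
    (hu.differentiableOn (by norm_num) q hq).hasFDerivWithinAt
  have hDd : ∀ q ∈ s, HasFDerivWithinAt D (DD q) s q := fun q hq =>
    (hD1.differentiableOn (by norm_num) q hq).hasFDerivWithinAt
  have hcm : ∀ q : ℝ × ℝ, (clamp T q.1, q.2) ∈ s := fun q => ⟨clamp_mem hT.le _, mem_univ _⟩
  have hc : Continuous fun q : ℝ × ℝ => (clamp T q.1, q.2) :=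
    ((continuous_clamp T).comp continuous_fst).prodMk continuous_snd
  have cF : Continuous fun q : ℝ × ℝ => F (clamp T q.1, q.2) :=
    hu.continuousOn.comp_continuous hc hcm
  have cD : Continuous fun q : ℝ × ℝ => D (clamp T q.1, q.2) :=
    hD1.continuousOn.comp_continuous hc hcm
  have cDD : Continuous fun q : ℝ × ℝ => DD (clamp T q.1, q.2) := hD2.comp_continuous hc hcm
  have hline : ∀ t x : ℝ, HasDerivAt (fun y : ℝ => (t, y)) ((0 : ℝ), (1 : ℝ)) x := fun t x =>
    (hasDerivAt_const x t).prodMk (hasDerivAt_id x)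
  have hlinet : ∀ t x : ℝ, HasDerivAt (fun r : ℝ => (r, x)) ((1 : ℝ), (0 : ℝ)) t := fun t x =>
    (hasDerivAt_id t).prodMk (hasDerivAt_const t x)
  have hnhds : ∀ t ∈ Ioo 0 T, ∀ x : ℝ, s ∈ nhds (t, x) := fun t ht x =>
    prod_mem_nhds (Icc_mem_nhds ht.1 ht.2) Filter.univ_mem
  have hms : ∀ t ∈ Ioo 0 T, ∀ x : ℝ, (t, x) ∈ s := fun t ht x => mem_of_mem_nhds (hnhds t ht x)
  have hI : ∀ t ∈ Ioo 0 T, clamp T t = t := fun t ht => clamp_of_mem (Ioo_subset_Icc_self ht)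
  have hsymm : ∀ t ∈ Ioo 0 T, ∀ x : ℝ, DD (t, x) (0, 1) (1, 0) = DD (t, x) (1, 0) (0, 1) := by
    intro t ht x
    refine second_derivative_symmetric_of_eventually (𝕜 := ℝ) (f := F) (f' := D) (x := (t, x)) ?_
      ((hDd _ (hms t ht x)).hasFDerivAt (hnhds t ht x)) (0, 1) (1, 0)
    have : Ioo 0 T ×ˢ univ ∈ nhds (t, x) :=
      prod_mem_nhds (Ioo_mem_nhds ht.1 ht.2) Filter.univ_mem
    filter_upwards [this] with q hq
    exact (hFd _ (hms q.1 hq.1 q.2)).hasFDerivAt (hnhds q.1 hq.1 q.2)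
  have heval : ∀ {f : ℝ → ℝ × ℝ →L[ℝ] E} {f' : ℝ × ℝ →L[ℝ] E} {y : ℝ} (e : ℝ × ℝ),
      HasDerivAt f f' y → HasDerivAt (fun r => f r e) (f' e) y := fun e hf =>
    (ContinuousLinearMap.apply ℝ E e).hasFDerivAt.comp_hasDerivAt _ hf
  refine ⟨fun t x => F (clamp T t, x), fun t x => D (clamp T t, x) (1, 0),
    fun t x => D (clamp T t, x) (0, 1), fun t x => DD (clamp T t, x) (1, 0) (0, 1),
    fun t x => DD (clamp T t, x) (0, 1) (0, 1), ?_, fun t x => rfl⟩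
  exact
  { cont := cF
    cont_t := cD.clm_apply continuous_const
    cont_x := cD.clm_apply continuous_const
    cont_xt := (cDD.clm_apply continuous_const).clm_apply continuous_const
    cont_xx := (cDD.clm_apply continuous_const).clm_apply continuous_const
    deriv_x := fun t x =>
      (hFd _ (hcm (t, x))).comp_hasDerivAt x (hline _ x) (Filter.Eventually.of_forall
        fun y => hcm (t, y))
    deriv_t := fun t ht x => by
      simp only [hI t ht]
      refine HasDerivAt.congr_of_eventuallyEq
        (((hFd _ (hms t ht x)).hasFDerivAt (hnhds t ht x)).comp_hasDerivAt t (hlinet t x)) ?_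
      filter_upwards [clamp_eventuallyEq ht] with r hr
      simp [hr]
    deriv_x_x := fun t ht x => by
      simp only [hI t ht]
      exact heval _ (((hDd _ (hms t ht x)).hasFDerivAt (hnhds t ht x)).comp_hasDerivAt x
        (hline t x))
    deriv_x_t := fun t ht x => by
      simp only [hI t ht]
      refine HasDerivAt.congr_of_eventuallyEq
        (heval (0, 1) (((hDd _ (hms t ht x)).hasFDerivAt (hnhds t ht x)).comp_hasDerivAt t
        (hlinet t x))) ?_
      filter_upwards [clamp_eventuallyEq ht] with r hr
      simp [hr]
    deriv_t_x := fun t ht x => by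
      simp only [hI t ht]
      rw [← hsymm t ht x]
      exact heval _ (((hDd _ (hms t ht x)).hasFDerivAt (hnhds t ht x)).comp_hasDerivAt x
        (hline t x)) }

end

/-! ### Weighted energy estimate for diagonal systems -/

theorem hasDerivAt_expNegInvGlue (s : ℝ) : HasDerivAt expNegInvGlue (deriv expNegInvGlue s) s :=
  ((expNegInvGlue.contDiff (n := 1)).differentiable (by norm_num) s).hasDerivAt

theorem deriv_expNegInvGlue_nonneg (s : ℝ) : 0 ≤ deriv expNegInvGlue s :=
  expNegInvGlue.monotone.deriv_nonneg

theorem continuous_deriv_expNegInvGlue : Continuous (deriv expNegInvGlue) :=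
  (expNegInvGlue.contDiff (n := 1)).continuous_deriv (by norm_num)

/-- Gronwall's inequality with vanishing initial value, with the derivative given only at interior
times. -/
theorem nonpos_of_hasDerivAt_le_mul {τ k : ℝ} {E E' : ℝ → ℝ} (hE : Continuous E)
    (hd : ∀ t ∈ Ioo 0 τ, HasDerivAt E (E' t) t) (hle : ∀ t ∈ Ioo 0 τ, E' t ≤ k * E t)
    (h0 : E 0 = 0) {t : ℝ} (ht : t ∈ Icc 0 τ) : E t ≤ 0 := by
  have hder : ∀ s ∈ Ioo 0 τ, HasDerivAt (fun s => Real.exp (-k * s) * E s)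
      (Real.exp (-k * s) * (E' s - k * E s)) s := fun s hs => by
    have h1 : HasDerivAt (fun s => Real.exp (-k * s)) (Real.exp (-k * s) * (-k)) s := by
      have := ((hasDerivAt_id s).const_mul (-k)).exp
      simpa using this
    exact (h1.mul (hd s hs)).congr_deriv (by ring)
  have hanti : AntitoneOn (fun s => Real.exp (-k * s) * E s) (Icc 0 τ) := by
    refine antitoneOn_of_deriv_nonpos (convex_Icc _ _) (by fun_prop) ?_ ?_
    · rw [interior_Icc]
      exact fun s hs => (hder s hs).differentiableAt.differentiableWithinAt
    · rw [interior_Icc]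
      intro s hs
      rw [(hder s hs).deriv]
      exact mul_nonpos_of_nonneg_of_nonpos (Real.exp_pos _).le (by linarith [hle s hs])
  have := hanti ⟨le_rfl, ht.1.trans ht.2⟩ ht ht.1
  simp only [h0, mul_zero] at this
  by_contra! hpos
  have := mul_pos (Real.exp_pos (-k * t)) hpos
  linarith

/-- Uniqueness with finite speed of propagation: if the derivatives of the `v_i` along the constant
speeds `lam i` are `O(|v|)` and `v` vanishes initially on `[b₁, b₂]`, then `v` vanishes on the
trapezoid `b₁ + K t < x < b₂ - K t`, where `K` bounds the speeds. The energy `∫ χ |v|²` is weighted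
by a cutoff `χ` supported in the trapezoid and nonincreasing along all characteristics. -/
theorem eq_zero_of_diagonal_system {ι : Type*} [Fintype ι] {τ K C b₁ b₂ : ℝ} {lam : ι → ℝ}
    {v vt vx : ι → ℝ → ℝ → ℝ} (hK : 0 ≤ K) (hlam : ∀ i, |lam i| ≤ K)
    (cv : ∀ i, Continuous fun q : ℝ × ℝ => v i q.1 q.2)
    (cvt : ∀ i, Continuous fun q : ℝ × ℝ => vt i q.1 q.2)
    (cvx : ∀ i, Continuous fun q : ℝ × ℝ => vx i q.1 q.2)
    (hvt : ∀ i, ∀ t ∈ Ioo 0 τ, ∀ x, HasDerivAt (fun s => v i s x) (vt i t x) t)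
    (hvx : ∀ i, ∀ t ∈ Ioo 0 τ, ∀ x, HasDerivAt (v i t) (vx i t x) x)
    (heq : ∀ i, ∀ t ∈ Ioo 0 τ, ∀ x ∈ Icc b₁ b₂,
      |vt i t x + lam i * vx i t x| ≤ C * ∑ j, |v j t x|)
    (h0 : ∀ i, ∀ x ∈ Icc b₁ b₂, v i 0 x = 0) (hC : 0 ≤ C) {t x : ℝ} (ht : t ∈ Icc 0 τ)
    (hx₁ : b₁ + K * t < x) (hx₂ : x < b₂ - K * t) (i : ι) : v i t x = 0 := by
  have hKt : 0 ≤ K * t := mul_nonneg hK ht.1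
  have hb : b₁ < b₂ := by linarith
  set f := expNegInvGlue with hf
  have cf : Continuous f := (expNegInvGlue.contDiff (n := 0)).continuous
  set f' := deriv expNegInvGlue with hf'
  have cf' : Continuous f' := continuous_deriv_expNegInvGlue
  have hfd : ∀ s, HasDerivAt f (f' s) s := hasDerivAt_expNegInvGlue
  have hf0 : ∀ s, 0 ≤ f s := expNegInvGlue.nonneg
  have hf'0 : ∀ s, 0 ≤ f' s := deriv_expNegInvGlue_nonneg
  set χ : ℝ → ℝ → ℝ := fun t x => f (x - b₁ - K * t) * f (b₂ - K * t - x) with hχ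
  set χt : ℝ → ℝ → ℝ := fun t x => f' (x - b₁ - K * t) * (-K) * f (b₂ - K * t - x) +
    f (x - b₁ - K * t) * (f' (b₂ - K * t - x) * (-K)) with hχt
  set χx : ℝ → ℝ → ℝ := fun t x => f' (x - b₁ - K * t) * f (b₂ - K * t - x) +
    f (x - b₁ - K * t) * (f' (b₂ - K * t - x) * (-1)) with hχx
  have cχ : Continuous fun q : ℝ × ℝ => χ q.1 q.2 := by simp only [hχ]; fun_prop
  have cχt : Continuous fun q : ℝ × ℝ => χt q.1 q.2 := by simp only [hχt]; fun_prop
  have cχx : Continuous fun q : ℝ × ℝ => χx q.1 q.2 := by simp only [hχx]; fun_prop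
  have hχ0 : ∀ t x, 0 ≤ χ t x := fun t x => mul_nonneg (hf0 _) (hf0 _)
  have dχt : ∀ t x, HasDerivAt (fun s => χ s x) (χt t x) t := fun t x => by
    have e1 : HasDerivAt (fun s => x - b₁ - K * s) (-K) t := by
      simpa using ((hasDerivAt_id t).const_mul K).const_sub (x - b₁)
    have e2 : HasDerivAt (fun s => b₂ - K * s - x) (-K) t := by
      simpa using (((hasDerivAt_id t).const_mul K).const_sub b₂).sub_const x
    exact ((hfd _).comp t e1).mul ((hfd _).comp t e2)
  have dχx : ∀ t x, HasDerivAt (χ t) (χx t x) x := fun t x => by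
    have e1 : HasDerivAt (fun y => y - b₁ - K * t) 1 x :=
      ((hasDerivAt_id x).sub_const b₁).sub_const (K * t)
    have e2 : HasDerivAt (fun y => b₂ - K * t - y) (-1) x := by
      simpa using (hasDerivAt_id x).const_sub (b₂ - K * t)
    have := ((hfd _).comp x e1).mul ((hfd _).comp x e2)
    rw [mul_one] at this
    exact this
  -- The weight is nonincreasing along each characteristic, as both factors move at speed `K`.
  have htrans : ∀ i t x, χt t x + lam i * χx t x ≤ 0 := fun i t x => by
    have e : χt t x + lam i * χx t x =
        -(f' (x - b₁ - K * t) * f (b₂ - K * t - x) * (K - lam i)) -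
        f (x - b₁ - K * t) * f' (b₂ - K * t - x) * (K + lam i) := by
      simp only [hχt, hχx]; ring
    have h1 := abs_le.1 (hlam i)
    have := mul_nonneg (mul_nonneg (hf'0 (x - b₁ - K * t)) (hf0 (b₂ - K * t - x)))
      (by linarith : 0 ≤ K - lam i)
    have := mul_nonneg (mul_nonneg (hf0 (x - b₁ - K * t)) (hf'0 (b₂ - K * t - x)))
      (by linarith : 0 ≤ K + lam i)
    linarith
  set e : ℝ → ℝ → ℝ := fun t x => χ t x * ∑ i, v i t x ^ 2 with he
  set et : ℝ → ℝ → ℝ := fun t x => χt t x * (∑ i, v i t x ^ 2) +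
    χ t x * ∑ i, 2 * v i t x * vt i t x with het
  have cv2 : Continuous fun q : ℝ × ℝ => ∑ i, v i q.1 q.2 ^ 2 :=
    continuous_finsetSum _ fun i _ => (cv i).fun_pow 2
  have ce : Continuous fun q : ℝ × ℝ => e q.1 q.2 := cχ.mul cv2
  have cet : Continuous fun q : ℝ × ℝ => et q.1 q.2 := (cχt.mul cv2).add
    (cχ.mul (continuous_finsetSum _ fun i _ => (continuous_const.mul (cv i)).mul (cvt i)))
  have det : ∀ t ∈ Ioo 0 τ, ∀ x, HasDerivAt (fun s => e s x) (et t x) t := fun t ht x => by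
    refine (dχt t x).mul (HasDerivAt.fun_sum fun i _ => ?_)
    simpa using (hvt i t ht x).fun_pow 2
  set n : ℝ := (Fintype.card ι : ℝ) with hn
  set k : ℝ := 2 * C * n with hk
  have hE : ∀ t ∈ Ioo 0 τ, ∫ x in b₁..b₂, et t x ≤ k * ∫ x in b₁..b₂, e t x := by
    intro t ht
    have hKt : 0 ≤ K * t := mul_nonneg hK ht.1.le
    set D : ι → ℝ → ℝ := fun i x => χx t x * v i t x ^ 2 + χ t x * (2 * v i t x * vx i t x) with hD
    have cD : ∀ i, Continuous (D i) := fun i => by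
      have := cv i; have := cvx i
      simp only [hD]; fun_prop
    -- `D i` is the `x`-derivative of `χ v_i²`, and the weight vanishes at both ends.
    have hDint : ∀ i, ∫ x in b₁..b₂, D i x = 0 := fun i => by
      rw [integral_eq_sub_of_hasDerivAt (f := fun x => χ t x * v i t x ^ 2)
        (fun x _ => (dχx t x).mul (by simpa using (hvx i t ht x).fun_pow 2))
        ((cD i).intervalIntegrable _ _)]
      have z1 : χ t b₁ = 0 := by
        simp only [hχ, hf, expNegInvGlue.zero_of_nonpos (by linarith : b₁ - b₁ - K * t ≤ 0),
          zero_mul]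
      have z2 : χ t b₂ = 0 := by
        simp only [hχ, hf, expNegInvGlue.zero_of_nonpos (by linarith : b₂ - K * t - b₂ ≤ 0),
          mul_zero]
      rw [z1, z2]; ring
    have hpt : ∀ x ∈ Icc b₁ b₂, et t x ≤ k * e t x - ∑ i, lam i * D i x := by
      intro x hx
      have e1 : et t x = (∑ i, (χt t x + lam i * χx t x) * v i t x ^ 2) +
          χ t x * (∑ i, 2 * v i t x * (vt i t x + lam i * vx i t x)) - ∑ i, lam i * D i x := by
        simp only [het, hD, Finset.mul_sum, ← Finset.sum_add_distrib, ← Finset.sum_sub_distrib]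
        exact Finset.sum_congr rfl fun i _ => by ring
      have e2 : ∑ i, (χt t x + lam i * χx t x) * v i t x ^ 2 ≤ 0 :=
        Finset.sum_nonpos fun i _ =>
          mul_nonpos_of_nonpos_of_nonneg (htrans i t x) (sq_nonneg _)
      have e3 : ∑ i, 2 * v i t x * (vt i t x + lam i * vx i t x) ≤ k * ∑ i, v i t x ^ 2 := by
        calc ∑ i, 2 * v i t x * (vt i t x + lam i * vx i t x)
            ≤ ∑ i, 2 * |v i t x| * (C * ∑ j, |v j t x|) := by
              refine Finset.sum_le_sum fun i _ => (le_abs_self _).trans ?_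
              rw [abs_mul, abs_mul, abs_two]
              exact mul_le_mul_of_nonneg_left (heq i t ht x hx) (by positivity)
          _ = 2 * C * (∑ j, |v j t x|) ^ 2 := by
              rw [← Finset.sum_mul, ← Finset.mul_sum]; ring
          _ ≤ 2 * C * (n * ∑ i, |v i t x| ^ 2) := by
              refine mul_le_mul_of_nonneg_left ?_ (by positivity)
              exact sq_sum_le_card_mul_sum_sq
          _ = k * ∑ i, v i t x ^ 2 := by simp only [sq_abs, hk]; ring
      have e4 := mul_le_mul_of_nonneg_left e3 (hχ0 t x)
      have e5 : k * e t x = χ t x * (k * ∑ i, v i t x ^ 2) := by simp only [he]; ring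
      rw [e1, e5]; linarith
    have cDi : ∀ i, Continuous fun x => lam i * D i x := fun i => continuous_const.mul (cD i)
    have cDs : Continuous fun x => ∑ i, lam i * D i x := continuous_finsetSum _ fun i _ => cDi i
    have cet' : Continuous fun x => k * e t x := by fun_prop
    have hle : ∫ x in b₁..b₂, et t x ≤ ∫ x in b₁..b₂, (k * e t x - ∑ i, lam i * D i x) :=
      integral_mono_on hb.le (Continuous.intervalIntegrable (by fun_prop) _ _)
        ((cet'.sub cDs).intervalIntegrable _ _) hpt
    rw [integral_sub (cet'.intervalIntegrable _ _) (cDs.intervalIntegrable _ _),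
      intervalIntegral.integral_finsetSum fun i _ => (cDi i).intervalIntegrable _ _] at hle
    simpa only [intervalIntegral.integral_const_mul, hDint, mul_zero, Finset.sum_const_zero,
      sub_zero] using hle
  have hEt : ∫ x in b₁..b₂, e t x ≤ 0 := by
    refine nonpos_of_hasDerivAt_le_mul (k := k) (E := fun t => ∫ x in b₁..b₂, e t x) (by fun_prop)
      (fun s hs => hasDerivAt_intervalIntegral_of_continuous ce cet det b₁ b₂ hs) hE ?_ ht
    have : ∀ x ∈ uIcc b₁ b₂, e 0 x = 0 := fun x hx => by
      rw [uIcc_of_le hb.le] at hx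
      simp only [he, h0 _ x hx]; simp
    rw [intervalIntegral.integral_congr this]; simp
  by_contra hne
  have hpos : 0 < e t x := by
    refine mul_pos (mul_pos (expNegInvGlue.pos_of_pos (by linarith))
      (expNegInvGlue.pos_of_pos (by linarith))) ?_
    exact Finset.sum_pos' (fun j _ => sq_nonneg _) ⟨i, Finset.mem_univ i, by positivity⟩
  have : 0 < ∫ x in b₁..b₂, e t x := intervalIntegral.integral_pos hb
    (Continuous.continuousOn (by fun_prop))
    (fun y _ => mul_nonneg (hχ0 t y) (Finset.sum_nonneg fun j _ => sq_nonneg _))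
    ⟨x, ⟨by linarith, by linarith⟩, hpos⟩
  linarith

/-! ### Eigenframes and finite speed of propagation -/

theorem inner_eq_sum {N : ℕ} (x y : RN N) : inner ℝ x y = ∑ m, x m * y m := by
  simp [PiLp.inner_apply, mul_comm]

theorem exists_norm_le_mul_norm_of_compact {E F : Type*} [NormedAddCommGroup E] [NormedSpace ℝ E]
    [NormedAddCommGroup F] [NormedSpace ℝ F] {f : E → F} (hf : DifferentiableAt ℝ f 0)
    (h0 : f 0 = 0) {S : Set E} (hS : IsCompact S) (hc : ContinuousOn f S) :
    ∃ C, 0 ≤ C ∧ ∀ v ∈ S, ‖f v‖ ≤ C * ‖v‖ := by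
  obtain ⟨C, hC⟩ := (hf.isBigO_sub).bound
  obtain ⟨r, hr, hball⟩ := Metric.eventually_nhds_iff_ball.1 hC
  obtain ⟨B, hB⟩ := hS.exists_bound_of_continuousOn hc
  refine ⟨|C| + |B| / r, by positivity, fun v hv => ?_⟩
  by_cases hvr : ‖v‖ < r
  · have := hball v (by simpa using hvr)
    simp only [h0, sub_zero] at this
    refine this.trans (mul_le_mul_of_nonneg_right ?_ (norm_nonneg v))
    have := le_abs_self C
    have : 0 ≤ |B| / r := by positivity
    linarith
  · have h1 : |B| ≤ |B| / r * ‖v‖ := by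
      rw [div_mul_eq_mul_div, le_div_iff₀ hr]
      exact mul_le_mul_of_nonneg_left (not_lt.1 hvr) (abs_nonneg _)
    have h2 := (hB v hv).trans (le_abs_self B)
    have h3 : 0 ≤ |C| * ‖v‖ := by positivity
    linarith

namespace IsEigenframe

variable {N : ℕ} {Ω : Set (RN N)} {a : RN N → Matrix (Fin N) (Fin N) ℝ} {δ : ℝ}
  {lam : Fin N → RN N → ℝ} {l r : Fin N → RN N → RN N}

theorem zero_mem (h : IsEigenframe Ω a δ lam l r) : (0 : RN N) ∈ Metric.ball (0 : RN N) (2 * δ) :=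
  Metric.mem_ball_self (by linarith [h.pos])

/-- Expansion of a vector in the basis of right eigenvectors; the coefficients are the products
with the left eigenvectors. -/
theorem sum_inner_smul (h : IsEigenframe Ω a δ lam l r) {v : RN N}
    (hv : v ∈ Metric.ball (0 : RN N) (2 * δ)) (y : RN N) :
    ∑ j, (inner ℝ (l j v) y : ℝ) • r j v = y := by
  set L : Matrix (Fin N) (Fin N) ℝ := fun i m => l i v m with hL
  set P : Matrix (Fin N) (Fin N) ℝ := fun m j => r j v m with hP
  have h1 : L * P = 1 := by
    ext i j
    rw [Matrix.mul_apply, Matrix.one_apply]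
    exact h.biorthogonal v hv i j
  have h2 : P * L = 1 := mul_eq_one_comm.1 h1
  ext m
  have h3 : ((P * L).mulVec y.ofLp) m = y m := by rw [h2, Matrix.one_mulVec]
  rw [← Matrix.mulVec_mulVec] at h3
  rw [← h3]
  simp only [Matrix.mulVec, dotProduct, hL, hP, inner_eq_sum]
  simp [mul_comm]

theorem inner_left_right (h : IsEigenframe Ω a δ lam l r) {v : RN N}
    (hv : v ∈ Metric.ball (0 : RN N) (2 * δ)) (i j : Fin N) :
    inner ℝ (l i v) (r j v) = if i = j then (1 : ℝ) else 0 := by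
  rw [inner_eq_sum]; exact h.biorthogonal v hv i j

theorem sum_left_mul (h : IsEigenframe Ω a δ lam l r) {v : RN N}
    (hv : v ∈ Metric.ball (0 : RN N) (2 * δ)) (i : Fin N) (y : RN N) :
    ∑ m, l i v m * ∑ n, a v m n * y n = lam i v * inner ℝ (l i v) y := by
  rw [inner_eq_sum, Finset.mul_sum]
  calc ∑ m, l i v m * ∑ n, a v m n * y n = ∑ m, ∑ n, l i v m * a v m n * y n := by
        simp only [Finset.mul_sum, mul_assoc]
    _ = ∑ n, (∑ m, l i v m * a v m n) * y n := by
        rw [Finset.sum_comm]; simp only [Finset.sum_mul]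
    _ = _ := by
        simp only [h.left_eigen v hv i, mul_assoc]

theorem norm_le_sum_inner (h : IsEigenframe Ω a δ lam l r) {v : RN N}
    (hv : v ∈ Metric.ball (0 : RN N) (2 * δ)) {C : ℝ} (hC : ∀ j, ‖r j v‖ ≤ C) (y : RN N) :
    ‖y‖ ≤ C * ∑ j, |(inner ℝ (l j v) y : ℝ)| := by
  conv_lhs => rw [← h.sum_inner_smul hv y]
  rw [Finset.mul_sum]
  refine (norm_sum_le _ _).trans (Finset.sum_le_sum fun j _ => ?_)
  rw [norm_smul, Real.norm_eq_abs, mul_comm]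
  exact mul_le_mul_of_nonneg_right (hC j) (abs_nonneg _)

/-- A solution of `y' + a(v) y = σ G`, read in the left eigenvectors at the origin, solves a
diagonal system with the constant speeds `lam i 0`, up to an error `O(|v|)`. Freezing the
coefficients makes the error depend on a bound `M` for the derivative `y`, which is harmless for
uniqueness. -/
theorem abs_inner_add_le (h : IsEigenframe Ω a δ lam l r) {v y y' G : RN N} {σ M Cg : ℝ}
    {Ca : Fin N → Fin N → ℝ} (heq : ∀ m, y' m + ∑ n, a v m n * y n = σ * G m)
    (hCa : ∀ m n, |a v m n - a 0 m n| ≤ Ca m n * ‖v‖) (hy : ‖y‖ ≤ M) (hG : ‖G‖ ≤ Cg * ‖v‖)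
    (i : Fin N) :
    |(inner ℝ (l i 0) y' : ℝ) + lam i 0 * inner ℝ (l i 0) y| ≤
      ((∑ m, ∑ n, Ca m n * M) + |σ| * Cg) * ‖v‖ := by
  have hl : ∀ m, |l i 0 m| ≤ 1 := fun m => by
    have := PiLp.norm_apply_le (l i 0) m
    rwa [h.norm_l 0 h.zero_mem i] at this
  have e : (inner ℝ (l i 0) y' : ℝ) + lam i 0 * inner ℝ (l i 0) y =
      (∑ m, ∑ n, l i 0 m * (-(a v m n - a 0 m n) * y n)) + σ * inner ℝ (l i 0) G := by
    rw [← h.sum_left_mul h.zero_mem i, inner_eq_sum, inner_eq_sum, Finset.mul_sum,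
      ← Finset.sum_add_distrib, ← Finset.sum_add_distrib]
    refine Finset.sum_congr rfl fun m _ => ?_
    have e1 : y' m = σ * G m - ∑ n, a v m n * y n := by linarith [heq m]
    rw [e1, ← Finset.mul_sum]
    simp only [neg_sub, sub_mul, Finset.sum_sub_distrib]
    ring
  have b1 : |∑ m, ∑ n, l i 0 m * (-(a v m n - a 0 m n) * y n)| ≤
      (∑ m, ∑ n, Ca m n * M) * ‖v‖ := by
    refine (Finset.abs_sum_le_sum_abs _ _).trans ?_
    rw [Finset.sum_mul]
    refine Finset.sum_le_sum fun m _ => (Finset.abs_sum_le_sum_abs _ _).trans ?_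
    rw [Finset.sum_mul]
    refine Finset.sum_le_sum fun n _ => ?_
    rw [abs_mul, abs_mul, abs_neg]
    have c2 : |y n| ≤ M := (PiLp.norm_apply_le y n).trans hy
    have c3 := mul_le_mul (hCa m n) c2 (abs_nonneg _) ((abs_nonneg _).trans (hCa m n))
    calc |l i 0 m| * (|a v m n - a 0 m n| * |y n|) ≤ |a v m n - a 0 m n| * |y n| :=
          mul_le_of_le_one_left (by positivity) (hl m)
      _ ≤ _ := c3.trans_eq (by ring)
  have b2 : |σ * (inner ℝ (l i 0) G : ℝ)| ≤ |σ| * Cg * ‖v‖ := by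
    rw [abs_mul, mul_assoc]
    refine mul_le_mul_of_nonneg_left ?_ (abs_nonneg _)
    have := abs_real_inner_le_norm (l i 0) G
    rw [h.norm_l 0 h.zero_mem i, one_mul] at this
    exact this.trans hG
  rw [e, add_mul]
  exact (abs_add_le _ _).trans (add_le_add b1 b2)

/-- Finite speed of propagation for the nonlinear system around the equilibrium `0`. No smallness
of the solution is needed, since its values on a compact trapezoid form a compact subset of `Ω`. -/
theorem eq_zero_of_trapezoid (h : IsEigenframe Ω a δ lam l r) (hΩ : IsOpen Ω)
    (ha : ∀ m n, ContDiffOn ℝ ∞ (fun v => a v m n) Ω) {g : RN N → RN N} (hg : ContDiffOn ℝ ∞ g Ω)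
    (hg0 : g 0 = 0) {τ σ K b₁ b₂ : ℝ} {u ut ux uxt uxx : ℝ → ℝ → RN N}
    (hu : IsC2Strip τ u ut ux uxt uxx) (hmem : ∀ t x, u t x ∈ Ω)
    (heq : ∀ t ∈ Ioo 0 τ, ∀ x m, ut t x m + ∑ n, a (u t x) m n * ux t x n = σ * g (u t x) m)
    (hK : 0 ≤ K) (hlam : ∀ i, |lam i 0| ≤ K) (h0 : ∀ x ∈ Icc b₁ b₂, u 0 x = 0)
    {t x : ℝ} (ht : t ∈ Icc 0 τ) (hx₁ : b₁ + K * t < x) (hx₂ : x < b₂ - K * t) : u t x = 0 := by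
  have h00 := h.zero_mem
  have hΩ0 : (0 : RN N) ∈ Ω := h.ball_subset h00
  have hD : IsCompact (Icc 0 τ ×ˢ Icc b₁ b₂) := isCompact_Icc.prod isCompact_Icc
  set S : Set (RN N) := (fun q : ℝ × ℝ => u q.1 q.2) '' (Icc 0 τ ×ˢ Icc b₁ b₂) with hS
  have hSc : IsCompact S := hD.image hu.cont
  have hSΩ : S ⊆ Ω := by rintro _ ⟨q, _, rfl⟩; exact hmem _ _
  have hinf : ∀ {F : Type} [NormedAddCommGroup F] [NormedSpace ℝ F] {f : RN N → F},
      ContDiffOn ℝ ∞ f Ω → DifferentiableAt ℝ f 0 := fun hf =>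
    (hf.differentiableOn (by simp)).differentiableAt (hΩ.mem_nhds hΩ0)
  obtain ⟨Cg, hCg, hgS⟩ := exists_norm_le_mul_norm_of_compact (hinf hg) hg0 hSc
    (hg.continuousOn.mono hSΩ)
  have haS : ∀ m n, ∃ C, 0 ≤ C ∧ ∀ v ∈ S, ‖a v m n - a 0 m n‖ ≤ C * ‖v‖ := fun m n =>
    exists_norm_le_mul_norm_of_compact (f := fun v => a v m n - a 0 m n)
      ((hinf (ha m n)).sub_const _) (sub_self _) hSc
      (((ha m n).continuousOn.mono hSΩ).sub continuousOn_const)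
  choose Ca hCa haS using haS
  obtain ⟨M, hM⟩ := hD.exists_bound_of_continuousOn hu.cont_x.continuousOn
  set C₀ : ℝ := ∑ j, ‖r j 0‖ with hC₀
  have hrC : ∀ j, ‖r j 0‖ ≤ C₀ := fun j =>
    Finset.single_le_sum (f := fun j => ‖r j 0‖) (fun j _ => norm_nonneg _) (Finset.mem_univ j)
  have hC₀0 : 0 ≤ C₀ := Finset.sum_nonneg fun j _ => norm_nonneg _
  set C₁ : ℝ := (∑ m, ∑ n, Ca m n * |M|) + |σ| * Cg with hC₁
  have hC₁0 : 0 ≤ C₁ := add_nonneg (Finset.sum_nonneg fun m _ => Finset.sum_nonneg fun n _ =>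
    mul_nonneg (hCa m n) (abs_nonneg _)) (by positivity)
  have hz : ∀ i, (inner ℝ (l i 0) (u t x) : ℝ) = 0 := by
    refine eq_zero_of_diagonal_system (ι := Fin N) (τ := τ) (lam := fun i => lam i 0) (K := K)
      (C := C₁ * C₀) (b₁ := b₁) (b₂ := b₂)
      (v := fun i t x => inner ℝ (l i 0) (u t x)) (vt := fun i t x => inner ℝ (l i 0) (ut t x))
      (vx := fun i t x => inner ℝ (l i 0) (ux t x)) hK hlam
      (fun i => continuous_const.inner hu.cont) (fun i => continuous_const.inner hu.cont_t)
      (fun i => continuous_const.inner hu.cont_x) ?_ ?_ ?_ ?_ (by positivity) ht hx₁ hx₂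
    · intro i t ht x
      simpa using (hasDerivAt_const t (l i 0)).inner ℝ (hu.deriv_t t ht x)
    · intro i t _ x
      simpa using (hasDerivAt_const x (l i 0)).inner ℝ (hu.deriv_x t x)
    · intro i t ht x hx
      have hts : (t, x) ∈ Icc 0 τ ×ˢ Icc b₁ b₂ := ⟨Ioo_subset_Icc_self ht, hx⟩
      have huS : u t x ∈ S := ⟨(t, x), hts, rfl⟩
      have b0 := h.abs_inner_add_le (heq t ht x) (fun m n => haS m n _ huS)
        ((hM _ hts).trans (le_abs_self M)) (hgS _ huS) i
      have b3 := h.norm_le_sum_inner h00 hrC (u t x)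
      exact (b0.trans (mul_le_mul_of_nonneg_left b3 hC₁0)).trans_eq (by ring)
    · intro i x hx
      simp [h0 x hx]
  rw [← h.sum_inner_smul h00 (u t x)]
  simp [hz]

/-- A solution with compactly supported initial data keeps a compact support, growing with speed at
most `K`. -/
theorem eq_zero_of_lt_abs (h : IsEigenframe Ω a δ lam l r) (hΩ : IsOpen Ω)
    (ha : ∀ m n, ContDiffOn ℝ ∞ (fun v => a v m n) Ω) {g : RN N → RN N} (hg : ContDiffOn ℝ ∞ g Ω)
    (hg0 : g 0 = 0) {τ σ K ρ : ℝ} {u ut ux uxt uxx : ℝ → ℝ → RN N}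
    (hu : IsC2Strip τ u ut ux uxt uxx) (hmem : ∀ t x, u t x ∈ Ω)
    (heq : ∀ t ∈ Ioo 0 τ, ∀ x m, ut t x m + ∑ n, a (u t x) m n * ux t x n = σ * g (u t x) m)
    (hK : 0 ≤ K) (hlam : ∀ i, |lam i 0| ≤ K) (h0 : ∀ x, ρ ≤ |x| → u 0 x = 0)
    {t x : ℝ} (ht : t ∈ Icc 0 τ) (hx : ρ + K * t < |x|) : u t x = 0 := by
  rcases le_total 0 x with hx0 | hx0
  · rw [abs_of_nonneg hx0] at hx
    exact h.eq_zero_of_trapezoid hΩ ha hg hg0 hu hmem heq hK hlam (b₁ := ρ) (b₂ := x + K * t + 1)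
      (fun y hy => h0 y (hy.1.trans (le_abs_self y))) ht (by linarith) (by linarith)
  · rw [abs_of_nonpos hx0] at hx
    exact h.eq_zero_of_trapezoid hΩ ha hg hg0 hu hmem heq hK hlam (b₁ := x - K * t - 1) (b₂ := -ρ)
      (fun y hy => h0 y (by have := neg_abs_le y; linarith [hy.2])) ht (by linarith) (by linarith)

end IsEigenframe

/-! ### Uniform bounds for an eigenframe -/

/-- A common bound `C` on the closed ball `|v| ≤ δ` for the eigenframe, the reaction term `g` and
their first derivatives, and a Lipschitz bound at `0` for the derivatives `⟨Dλ_i, r_i⟩`. -/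
structure FrameBounds {N : ℕ} (g : RN N → RN N) (δ : ℝ) (lam : Fin N → RN N → ℝ)
    (l r : Fin N → RN N → RN N) (C : ℝ) : Prop where
  nonneg : 0 ≤ C
  left_deriv : ∀ i, ∀ v ∈ Metric.closedBall (0 : RN N) δ, ‖fderiv ℝ (l i) v‖ ≤ C
  right : ∀ i, ∀ v ∈ Metric.closedBall (0 : RN N) δ, ‖r i v‖ ≤ C
  speed : ∀ i, ∀ v ∈ Metric.closedBall (0 : RN N) δ, |lam i v| ≤ C
  speed_deriv : ∀ i, ∀ v ∈ Metric.closedBall (0 : RN N) δ, ‖fderiv ℝ (lam i) v‖ ≤ C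
  reaction : ∀ v ∈ Metric.closedBall (0 : RN N) δ, ‖g v‖ ≤ C
  reaction_deriv : ∀ v ∈ Metric.closedBall (0 : RN N) δ, ‖fderiv ℝ g v‖ ≤ C
  nonlinearity : ∀ i, ∀ v ∈ Metric.closedBall (0 : RN N) δ,
    |fderiv ℝ (lam i) v (r i v) - fderiv ℝ (lam i) 0 (r i 0)| ≤ C * ‖v‖

theorem exists_bound_of_finite {ι E F : Type*} [Fintype ι] [TopologicalSpace E]
    [NormedAddCommGroup F] {S : Set E} (hS : IsCompact S) {f : ι → E → F}
    (hf : ∀ i, ContinuousOn (f i) S) : ∃ C, 0 ≤ C ∧ ∀ i, ∀ v ∈ S, ‖f i v‖ ≤ C := by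
  choose c hc using fun i => hS.exists_bound_of_continuousOn (hf i)
  refine ⟨∑ i, |c i|, Finset.sum_nonneg fun i _ => abs_nonneg _, fun i v hv => ?_⟩
  exact ((hc i v hv).trans (le_abs_self _)).trans
    (Finset.single_le_sum (f := fun i => |c i|) (fun i _ => abs_nonneg _) (Finset.mem_univ i))

namespace IsEigenframe

variable {N : ℕ} {Ω : Set (RN N)} {a : RN N → Matrix (Fin N) (Fin N) ℝ} {δ : ℝ}
  {lam : Fin N → RN N → ℝ} {l r : Fin N → RN N → RN N}

theorem closedBall_subset (h : IsEigenframe Ω a δ lam l r) :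
    Metric.closedBall (0 : RN N) δ ⊆ Metric.ball (0 : RN N) (2 * δ) :=
  Metric.closedBall_subset_ball (by linarith [h.pos])

theorem exists_frameBounds (h : IsEigenframe Ω a δ lam l r) {g : RN N → RN N}
    (hg : ContDiffOn ℝ ∞ g Ω) : ∃ C, FrameBounds g δ lam l r C := by
  have hS : IsCompact (Metric.closedBall (0 : RN N) δ) := isCompact_closedBall _ _
  have hsub := h.closedBall_subset
  have hg' : ContDiffOn ℝ ∞ g (Metric.ball (0 : RN N) (2 * δ)) := hg.mono h.ball_subset
  have hfd : ∀ {F : Type} [NormedAddCommGroup F] [NormedSpace ℝ F] {f : RN N → F},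
      ContDiffOn ℝ ∞ f (Metric.ball (0 : RN N) (2 * δ)) →
      ContDiffOn ℝ ∞ (fderiv ℝ f) (Metric.ball (0 : RN N) (2 * δ)) := fun hf =>
    hf.fderiv_of_isOpen Metric.isOpen_ball (by simp)
  have hnl : ∀ i, ContDiffOn ℝ ∞ (fun v => fderiv ℝ (lam i) v (r i v))
      (Metric.ball (0 : RN N) (2 * δ)) := fun i => (hfd (h.smooth_lam i)).clm_apply (h.smooth_r i)
  obtain ⟨C₁, h1, H1⟩ := exists_bound_of_finite hS
    fun i => ((hfd (h.smooth_l i)).continuousOn.mono hsub)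
  obtain ⟨C₂, h2, H2⟩ := exists_bound_of_finite hS fun i => ((h.smooth_r i).continuousOn.mono hsub)
  obtain ⟨C₃, h3, H3⟩ := exists_bound_of_finite hS
    fun i => ((h.smooth_lam i).continuousOn.mono hsub)
  obtain ⟨C₄, h4, H4⟩ := exists_bound_of_finite hS
    fun i => ((hfd (h.smooth_lam i)).continuousOn.mono hsub)
  obtain ⟨C₅, h5, H5⟩ := exists_bound_of_finite (ι := Unit) hS
    fun _ => (hg'.continuousOn.mono hsub)
  obtain ⟨C₆, h6, H6⟩ := exists_bound_of_finite (ι := Unit) hS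
    fun _ => ((hfd hg').continuousOn.mono hsub)
  have H7 : ∀ i, ∃ C, 0 ≤ C ∧ ∀ v ∈ Metric.closedBall (0 : RN N) δ,
      ‖fderiv ℝ (lam i) v (r i v) - fderiv ℝ (lam i) 0 (r i 0)‖ ≤ C * ‖v‖ := fun i =>
    exists_norm_le_mul_norm_of_compact
      ((((hnl i).differentiableOn (by simp)).differentiableAt
        (Metric.isOpen_ball.mem_nhds h.zero_mem)).sub_const _) (sub_self _) hS
      (((hnl i).continuousOn.mono hsub).sub continuousOn_const)
  choose c7 h7 H7 using H7
  have h7' : 0 ≤ ∑ i, c7 i := Finset.sum_nonneg fun i _ => h7 i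
  exact ⟨C₁ + C₂ + C₃ + C₄ + C₅ + C₆ + ∑ i, c7 i,
    { nonneg := by positivity
      left_deriv := fun i v hv => (H1 i v hv).trans (by linarith)
      right := fun i v hv => (H2 i v hv).trans (by linarith)
      speed := fun i v hv => (H3 i v hv).trans (by linarith)
      speed_deriv := fun i v hv => (H4 i v hv).trans (by linarith)
      reaction := fun v hv => (H5 () v hv).trans (by linarith)
      reaction_deriv := fun v hv => (H6 () v hv).trans (by linarith)
      nonlinearity := fun i v hv => (H7 i v hv).trans (mul_le_mul_of_nonneg_right
        (by linarith [Finset.single_le_sum (f := c7) (fun i _ => h7 i) (Finset.mem_univ i)])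
        (norm_nonneg _)) }⟩

/-- The eigenvalues are uniformly separated on the closed ball. -/
theorem exists_gap (h : IsEigenframe Ω a δ lam l r) :
    ∃ m, 0 < m ∧ ∀ i j, i < j → ∀ v ∈ Metric.closedBall (0 : RN N) δ, m ≤ lam j v - lam i v := by
  have hS : IsCompact (Metric.closedBall (0 : RN N) δ) := isCompact_closedBall _ _
  have hsub := h.closedBall_subset
  have hex : ∀ q : Fin N × Fin N, ∃ m, 0 < m ∧ (q.1 < q.2 →
      ∀ v ∈ Metric.closedBall (0 : RN N) δ, m ≤ lam q.2 v - lam q.1 v) := by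
    intro q
    by_cases hq : q.1 < q.2
    · obtain ⟨v, hv, hmin⟩ := hS.exists_isMinOn (Metric.nonempty_closedBall.2 h.pos.le)
        (((h.smooth_lam q.2).continuousOn.mono hsub).sub
          ((h.smooth_lam q.1).continuousOn.mono hsub))
      exact ⟨_, sub_pos.2 (h.ordered v (hsub hv) _ _ hq), fun _ w hw => hmin hw⟩
    · exact ⟨1, one_pos, fun hq' => absurd hq' hq⟩
  choose m hm hle using hex
  rcases isEmpty_or_nonempty (Fin N × Fin N) with he | hne
  · exact ⟨1, one_pos, fun i j => (he.false (i, j)).elim⟩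
  · obtain ⟨q, hq⟩ := Finite.exists_min m
    exact ⟨m q, hm q, fun i j hij v hv => (hq (i, j)).trans (hle (i, j) hij v hv)⟩

end IsEigenframe

/-! ### Decomposition of a solution into waves -/

/-- The component `w_i = l_i(u) u_x` of `u_x` in the `i`-th characteristic family. -/
def wave {N : ℕ} (l : Fin N → RN N → RN N) (u ux : ℝ → ℝ → RN N) (i : Fin N) (t x : ℝ) : ℝ :=
  inner ℝ (l i (u t x)) (ux t x)

/-- The derivative of `wave l u ux i` in a direction `s`, where `us = ∂_s u` and `uxs = ∂_s u_x`.
-/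
def waveDeriv {N : ℕ} (l : Fin N → RN N → RN N) (u ux us uxs : ℝ → ℝ → RN N) (i : Fin N)
    (t x : ℝ) : ℝ :=
  inner ℝ (l i (u t x)) (uxs t x) + inner ℝ (fderiv ℝ (l i) (u t x) (us t x)) (ux t x)

/-- A solution of `u_t + a(u) u_x = σ g(u)` for times in `(0, τ)` with values in the ball
`|u| ≤ δ`, where the eigenframe is available, and with spatial support in `|x| ≤ R`. As in
`IsC2Strip`, the functions are defined for all times, so that `mem` and the support conditions need
no restriction on `t`. -/
structure IsSmallStrip {N : ℕ} (a : RN N → Matrix (Fin N) (Fin N) ℝ) (g : RN N → RN N)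
    (δ σ τ R : ℝ) (u ut ux uxt uxx : ℝ → ℝ → RN N) : Prop extends
    IsC2Strip τ u ut ux uxt uxx where
  mem : ∀ t x, u t x ∈ Metric.closedBall (0 : RN N) δ
  equation : ∀ t ∈ Ioo 0 τ, ∀ x m, ut t x m + ∑ n, a (u t x) m n * ux t x n = σ * g (u t x) m
  radius_pos : 0 < R
  supp : ∀ t x, R ≤ |x| → u t x = 0
  supp_x : ∀ t x, R ≤ |x| → ux t x = 0

namespace IsSmallStrip

variable {N : ℕ} {Ω : Set (RN N)} {a : RN N → Matrix (Fin N) (Fin N) ℝ} {g : RN N → RN N}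
  {δ σ τ R C : ℝ} {lam : Fin N → RN N → ℝ} {l r : Fin N → RN N → RN N}
  {u ut ux uxt uxx : ℝ → ℝ → RN N}

theorem hasFDerivAt_comp {F : Type*} [NormedAddCommGroup F] [NormedSpace ℝ F] {f : RN N → F}
    (hf : ContDiffOn ℝ ∞ f (Metric.ball 0 (2 * δ))) {v : RN N}
    (hv : v ∈ Metric.ball (0 : RN N) (2 * δ)) : HasFDerivAt f (fderiv ℝ f v) v :=
  ((hf.differentiableOn (by simp)).differentiableAt (Metric.isOpen_ball.mem_nhds hv)).hasFDerivAt

/-- The `i`-th wave is transported with the `i`-th eigenvalue. -/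
theorem isTransport (hu : IsSmallStrip a g δ σ τ R u ut ux uxt uxx)
    (h : IsEigenframe Ω a δ lam l r) (i : Fin N) :
    IsTransport τ R (wave l u ux i) (waveDeriv l u ux ut uxt i) (waveDeriv l u ux ux uxx i)
      (fun t x => lam i (u t x)) (fun t x => fderiv ℝ (lam i) (u t x) (ux t x)) := by
  have hm : ∀ t x, u t x ∈ Metric.ball (0 : RN N) (2 * δ) := fun t x =>
    h.closedBall_subset (hu.mem t x)
  have cl : Continuous fun q : ℝ × ℝ => l i (u q.1 q.2) :=
    (h.smooth_l i).continuousOn.comp_continuous hu.cont fun q => hm q.1 q.2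
  have cc : Continuous fun q : ℝ × ℝ => lam i (u q.1 q.2) :=
    (h.smooth_lam i).continuousOn.comp_continuous hu.cont fun q => hm q.1 q.2
  have cdl : Continuous fun q : ℝ × ℝ => fderiv ℝ (l i) (u q.1 q.2) :=
    ((h.smooth_l i).continuousOn_fderiv_of_isOpen Metric.isOpen_ball (by simp)).comp_continuous
      hu.cont fun q => hm q.1 q.2
  have cdc : Continuous fun q : ℝ × ℝ => fderiv ℝ (lam i) (u q.1 q.2) :=
    ((h.smooth_lam i).continuousOn_fderiv_of_isOpen Metric.isOpen_ball (by simp)).comp_continuous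
      hu.cont fun q => hm q.1 q.2
  exact
  { cont := cl.inner hu.cont_x
    cont_t := (cl.inner hu.cont_xt).add ((cdl.clm_apply hu.cont_t).inner hu.cont_x)
    cont_x := (cl.inner hu.cont_xx).add ((cdl.clm_apply hu.cont_x).inner hu.cont_x)
    cont_speed := cc
    cont_speed_x := cdc.clm_apply hu.cont_x
    deriv_t := fun t ht x =>
      ((hasFDerivAt_comp (h.smooth_l i) (hm t x)).comp_hasDerivAt t
        (hu.deriv_t t ht x)).inner ℝ (hu.deriv_x_t t ht x)
    deriv_x := fun t ht x =>
      ((hasFDerivAt_comp (h.smooth_l i) (hm t x)).comp_hasDerivAt x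
        (hu.deriv_x t x)).inner ℝ (hu.deriv_x_x t ht x)
    deriv_speed := fun t _ x =>
      (hasFDerivAt_comp (h.smooth_lam i) (hm t x)).comp_hasDerivAt x (hu.deriv_x t x)
    supp := fun t x hx => by simp [wave, hu.supp_x t x hx]
    radius_pos := hu.radius_pos }

/-- The source of the `i`-th wave in conservation form. By `l_i u_t + λ_i w_i = σ l_i g` the flux
`λ_i w_i` is `σ l_i g - l_i u_t`, so the mixed derivative `u_xt` cancels, and what remains of the
homogeneous part is the antisymmetric expression `⟨Dl_i u_t, u_x⟩ - ⟨Dl_i u_x, u_t⟩`. -/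
theorem source_eq (hu : IsSmallStrip a g δ σ τ R u ut ux uxt uxx)
    (h : IsEigenframe Ω a δ lam l r) (hg : ContDiffOn ℝ ∞ g Ω) (i : Fin N) {t : ℝ}
    (ht : t ∈ Ioo 0 τ) (x : ℝ) :
    transportSource (wave l u ux i) (waveDeriv l u ux ut uxt i) (waveDeriv l u ux ux uxx i)
      (fun t x => lam i (u t x)) (fun t x => fderiv ℝ (lam i) (u t x) (ux t x)) t x =
      (inner ℝ (fderiv ℝ (l i) (u t x) (ut t x)) (ux t x) -
        inner ℝ (fderiv ℝ (l i) (u t x) (ux t x)) (ut t x)) +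
      σ * (inner ℝ (l i (u t x)) (fderiv ℝ g (u t x) (ux t x)) +
        inner ℝ (fderiv ℝ (l i) (u t x) (ux t x)) (g (u t x))) := by
  have hm : ∀ t x, u t x ∈ Metric.ball (0 : RN N) (2 * δ) := fun t x =>
    h.closedBall_subset (hu.mem t x)
  have hT := hu.isTransport h i
  have hl := (hasFDerivAt_comp (h.smooth_l i) (hm t x)).comp_hasDerivAt x (hu.deriv_x t x)
  have hgd := (hasFDerivAt_comp (hg.mono h.ball_subset) (hm t x)).comp_hasDerivAt x
    (hu.deriv_x t x)
  have d1 := (hT.deriv_speed t ht x).mul (hT.deriv_x t ht x)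
  have d2 := (hl.inner ℝ hgd).const_mul σ |>.sub (hl.inner ℝ (hu.deriv_t_x t ht x))
  -- The equation multiplied by `l_i` expresses the flux `λ_i w_i` without `u_x`.
  have hfun : (fun y => lam i (u t y)) * wave l u ux i t =
      (fun y => σ * (inner ℝ ((l i ∘ u t) y) ((g ∘ u t) y) : ℝ)) -
        fun y => (inner ℝ ((l i ∘ u t) y) (ut t y) : ℝ) := by
    funext y
    simp only [Pi.mul_apply, Pi.sub_apply, Function.comp_apply, wave]
    rw [← h.sum_left_mul (hm t y) i, inner_eq_sum, inner_eq_sum, Finset.mul_sum,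
      ← Finset.sum_sub_distrib]
    refine Finset.sum_congr rfl fun m _ => ?_
    have := hu.equation t ht y m
    rw [show ∑ n, a (u t y) m n * ux t y n = σ * g (u t y) m - ut t y m by linarith]
    ring
  -- The two expressions of the flux have the same `x`-derivative, and `u_xt` occurs in the second.
  have key := (hfun ▸ d1).unique d2
  unfold transportSource
  simp only [Function.comp_apply] at key
  rw [key]
  simp only [waveDeriv]
  ring

end IsSmallStrip

/-! ### Antisymmetry of the wave interactions -/

section
variable {ι E : Type*} [Fintype ι] [NormedAddCommGroup E] [InnerProductSpace ℝ E]

/-- Expansion of an antisymmetric bilinear expression in a family of vectors. The coefficient of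
`c_j d_k` vanishes for `j = k`. -/
theorem inner_sub_inner_sum (L : E →L[ℝ] E) (c d : ι → ℝ) (e : ι → E) :
    (inner ℝ (L (∑ j, c j • e j)) (∑ k, d k • e k) : ℝ) -
      inner ℝ (L (∑ k, d k • e k)) (∑ j, c j • e j) =
      ∑ j, ∑ k, c j * d k * (inner ℝ (L (e j)) (e k) - inner ℝ (L (e k)) (e j)) := by
  have h1 : ∀ c d : ι → ℝ, (inner ℝ (L (∑ j, c j • e j)) (∑ k, d k • e k) : ℝ) =
      ∑ j, ∑ k, c j * d k * inner ℝ (L (e j)) (e k) := fun c d => by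
    simp only [map_sum, map_smul, sum_inner, inner_sum, inner_smul_left, inner_smul_right,
      RCLike.conj_to_real, Finset.mul_sum]
    rw [Finset.sum_comm]
    exact Finset.sum_congr rfl fun j _ => Finset.sum_congr rfl fun k _ => by ring
  rw [h1, h1, Finset.sum_comm (f := fun j k => d j * c k * inner ℝ (L (e j)) (e k)),
    ← Finset.sum_sub_distrib]
  refine Finset.sum_congr rfl fun j _ => ?_
  rw [← Finset.sum_sub_distrib]
  exact Finset.sum_congr rfl fun k _ => by ring

theorem abs_inner_clm_le (L : E →L[ℝ] E) {C : ℝ} (hL : ‖L‖ ≤ C) (x y : E) :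
    |(inner ℝ (L x) y : ℝ)| ≤ C * ‖x‖ * ‖y‖ :=
  (abs_real_inner_le_norm _ _).trans (mul_le_mul_of_nonneg_right
    ((L.le_opNorm x).trans (mul_le_mul_of_nonneg_right hL (norm_nonneg _))) (norm_nonneg _))

/-- When the two vectors are `∑ λ_j d_j e_j` and `∑ d_j e_j`, the antisymmetric expression contains
only products of distinct components of `d`. -/
theorem abs_inner_sub_inner_sum_le [DecidableEq ι] (L : E →L[ℝ] E) {C : ℝ} (hC : 0 ≤ C)
    (hL : ‖L‖ ≤ C) (lam d : ι → ℝ) (e : ι → E) (hlam : ∀ j, |lam j| ≤ C) (he : ∀ j, ‖e j‖ ≤ C) :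
    |(inner ℝ (L (∑ j, (lam j * d j) • e j)) (∑ k, d k • e k) : ℝ) -
      inner ℝ (L (∑ k, d k • e k)) (∑ j, (lam j * d j) • e j)| ≤ 2 * C ^ 4 * crossSum d := by
  rw [inner_sub_inner_sum, crossSum, Finset.mul_sum]
  refine (Finset.abs_sum_le_sum_abs _ _).trans (Finset.sum_le_sum fun j _ => ?_)
  rw [Finset.mul_sum]
  refine (Finset.abs_sum_le_sum_abs _ _).trans (Finset.sum_le_sum fun k _ => ?_)
  by_cases hjk : j = k
  · simp [hjk]
  · have h3 : ∀ i k, |(inner ℝ (L (e i)) (e k) : ℝ)| ≤ C * C * C := fun i k =>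
      (abs_inner_clm_le L hL _ _).trans (mul_le_mul (mul_le_mul_of_nonneg_left (he i) hC) (he k)
        (norm_nonneg _) (by positivity))
    have h4 : |(inner ℝ (L (e j)) (e k) : ℝ) - inner ℝ (L (e k)) (e j)| ≤ 2 * C ^ 3 := by
      refine (abs_sub _ _).trans ?_
      nlinarith [h3 j k, h3 k j]
    rw [if_neg hjk, abs_mul, abs_mul, abs_mul]
    calc |lam j| * |d j| * |d k| * |(inner ℝ (L (e j)) (e k) : ℝ) - inner ℝ (L (e k)) (e j)|
        ≤ C * |d j| * |d k| * (2 * C ^ 3) := by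
          gcongr
          exact hlam j
      _ = _ := by ring

end

namespace IsSmallStrip

variable {N : ℕ} {Ω : Set (RN N)} {a : RN N → Matrix (Fin N) (Fin N) ℝ} {g : RN N → RN N}
  {δ σ τ R C : ℝ} {lam : Fin N → RN N → ℝ} {l r : Fin N → RN N → RN N}
  {u ut ux uxt uxx : ℝ → ℝ → RN N}

theorem norm_deriv_x_le (hu : IsSmallStrip a g δ σ τ R u ut ux uxt uxx)
    (h : IsEigenframe Ω a δ lam l r) (hC : FrameBounds g δ lam l r C) (t x : ℝ) :
    ‖ux t x‖ ≤ C * ∑ j, |wave l u ux j t x| :=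
  h.norm_le_sum_inner (h.closedBall_subset (hu.mem t x)) (fun j => hC.right j _ (hu.mem t x)) _

/-- The sources of the waves contain only products of waves of different families and, with the
small factor `σ`, terms linear in the waves. -/
theorem abs_source_le (hu : IsSmallStrip a g δ σ τ R u ut ux uxt uxx)
    (h : IsEigenframe Ω a δ lam l r) (hg : ContDiffOn ℝ ∞ g Ω) (hC : FrameBounds g δ lam l r C)
    (hσ : 0 ≤ σ) (i : Fin N) {t : ℝ} (ht : t ∈ Ioo 0 τ) (x : ℝ) :
    |transportSource (wave l u ux i) (waveDeriv l u ux ut uxt i) (waveDeriv l u ux ux uxx i)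
      (fun t x => lam i (u t x)) (fun t x => fderiv ℝ (lam i) (u t x) (ux t x)) t x| ≤
      2 * C ^ 4 * crossSum (fun j => wave l u ux j t x) +
        σ * (3 * C ^ 3 + C ^ 2) * ∑ j, |wave l u ux j t x| := by
  have hv := h.closedBall_subset (hu.mem t x)
  have hvc := hu.mem t x
  have hC0 := hC.nonneg
  rw [hu.source_eq h hg i ht x]
  set L := fderiv ℝ (l i) (u t x) with hL
  have hLn : ‖L‖ ≤ C := hC.left_deriv i _ hvc
  have eux : ux t x = ∑ k, wave l u ux k t x • r k (u t x) := (h.sum_inner_smul hv _).symm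
  set Y : RN N := ∑ j, (lam j (u t x) * wave l u ux j t x) • r j (u t x) with hY
  have eut : ut t x = σ • g (u t x) - Y := by
    rw [← h.sum_inner_smul hv (ut t x)]
    conv_rhs => rw [← h.sum_inner_smul hv (g (u t x)), Finset.smul_sum, hY,
      ← Finset.sum_sub_distrib]
    refine Finset.sum_congr rfl fun j _ => ?_
    rw [smul_smul, ← sub_smul]
    congr 1
    simp only [wave]
    rw [← h.sum_left_mul hv j, inner_eq_sum, inner_eq_sum, Finset.mul_sum,
      ← Finset.sum_sub_distrib]
    refine Finset.sum_congr rfl fun m _ => ?_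
    have := hu.equation t ht x m
    rw [show ut t x m = σ * g (u t x) m - ∑ n, a (u t x) m n * ux t x n by linarith]
    ring
  -- Inserting `u_t = σ g - ∑ λ_j w_j r_j`: the terms with `⟨Dl_i u_x, g⟩` cancel.
  have e : (inner ℝ (L (ut t x)) (ux t x) : ℝ) - inner ℝ (L (ux t x)) (ut t x) +
      σ * (inner ℝ (l i (u t x)) (fderiv ℝ g (u t x) (ux t x)) +
        inner ℝ (L (ux t x)) (g (u t x))) =
      -((inner ℝ (L Y) (ux t x) : ℝ) - inner ℝ (L (ux t x)) Y) +
      σ * (inner ℝ (L (g (u t x))) (ux t x) +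
        inner ℝ (l i (u t x)) (fderiv ℝ g (u t x) (ux t x))) := by
    rw [eut]
    simp only [map_sub, map_smul, inner_sub_left, inner_sub_right, inner_smul_left,
      inner_smul_right, RCLike.conj_to_real]
    ring
  have b1 : |(inner ℝ (L Y) (ux t x) : ℝ) - inner ℝ (L (ux t x)) Y| ≤
      2 * C ^ 4 * crossSum (fun j => wave l u ux j t x) := by
    rw [eux]
    exact abs_inner_sub_inner_sum_le L hC0 hLn (fun j => lam j (u t x))
      (fun j => wave l u ux j t x) (fun j => r j (u t x)) (fun j => hC.speed j _ hvc)
      (fun j => hC.right j _ hvc)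
  have hn := hu.norm_deriv_x_le h hC t x
  set W := ∑ j, |wave l u ux j t x| with hW
  have hW0 : 0 ≤ W := Finset.sum_nonneg fun j _ => abs_nonneg _
  have b2 : |(inner ℝ (L (g (u t x))) (ux t x) : ℝ)| ≤ C ^ 3 * W := by
    refine (abs_inner_clm_le L hLn _ _).trans ?_
    calc C * ‖g (u t x)‖ * ‖ux t x‖ ≤ C * C * (C * W) := by
          gcongr
          exact hC.reaction _ hvc
      _ = C ^ 3 * W := by ring
  have b3 : |(inner ℝ (l i (u t x)) (fderiv ℝ g (u t x) (ux t x)) : ℝ)| ≤ C ^ 2 * W := by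
    refine (abs_real_inner_le_norm _ _).trans ?_
    rw [h.norm_l _ hv i, one_mul]
    refine ((fderiv ℝ g (u t x)).le_opNorm _).trans ?_
    calc ‖fderiv ℝ g (u t x)‖ * ‖ux t x‖ ≤ C * (C * W) := by
          gcongr
          exact hC.reaction_deriv _ hvc
      _ = C ^ 2 * W := by ring
  rw [e]
  refine (abs_add_le _ _).trans (add_le_add ?_ ?_)
  · rw [abs_neg]; exact b1
  · rw [abs_mul, abs_of_nonneg hσ, mul_assoc]
    refine mul_le_mul_of_nonneg_left ((abs_add_le _ _).trans ?_) hσ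
    have : 0 ≤ C ^ 3 * W := by positivity
    nlinarith

end IsSmallStrip

/-! ### Total variation along the evolution -/

/-- The continuity method: if `V 0 < B`, and `V ≤ B` up to a time improves to `V < B` at that time,
then `V < B` throughout. -/
theorem forall_lt_of_bootstrap {V : ℝ → ℝ} {B T : ℝ} (hV : Continuous V) (h0 : V 0 < B)
    (hstep : ∀ τ ∈ Icc 0 T, (∀ s ∈ Icc 0 τ, V s ≤ B) → V τ < B) {t : ℝ} (ht : t ∈ Icc 0 T) :
    V t < B := by
  by_contra! hB
  have hS : IsCompact (Icc 0 T ∩ {s | B ≤ V s}) :=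
    isCompact_Icc.inter_right (isClosed_le continuous_const hV)
  -- The first time at which `V` reaches `B`.
  obtain ⟨t₀, ⟨ht₀, hBt⟩, hmin⟩ := hS.exists_isLeast ⟨t, ht, hB⟩
  have hBt : B ≤ V t₀ := hBt
  have hlt : ∀ s ∈ Icc 0 t₀, s ≠ t₀ → V s < B := fun s hs hne => by
    by_contra! hc
    exact hne (le_antisymm hs.2 (hmin ⟨⟨hs.1, hs.2.trans ht₀.2⟩, hc⟩))
  obtain ⟨s, hs, hsB⟩ := intermediate_value_Icc ht₀.1 hV.continuousOn ⟨h0.le, hBt⟩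
  have hst : s = t₀ := by
    by_contra hne
    exact (hlt s hs hne).ne hsB
  have hle : ∀ s ∈ Icc 0 t₀, V s ≤ B := fun q hq => by
    by_cases hqt : q = t₀
    · rw [hqt, ← hst]; exact hsB.le
    · exact (hlt q hq hqt).le
  exact (hstep t₀ ht₀ hle).not_ge hBt

namespace IsSmallStrip

variable {N : ℕ} {Ω : Set (RN N)} {a : RN N → Matrix (Fin N) (Fin N) ℝ} {g : RN N → RN N}
  {δ σ τ R C : ℝ} {lam : Fin N → RN N → ℝ} {l r : Fin N → RN N → RN N}
  {u ut ux uxt uxx : ℝ → ℝ → RN N}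

theorem abs_wave_le (hu : IsSmallStrip a g δ σ τ R u ut ux uxt uxx)
    (h : IsEigenframe Ω a δ lam l r) (i : Fin N) (t x : ℝ) : |wave l u ux i t x| ≤ ‖ux t x‖ := by
  have := abs_real_inner_le_norm (l i (u t x)) (ux t x)
  rwa [h.norm_l _ (h.closedBall_subset (hu.mem t x)), one_mul] at this

/-- The constant in the bound of the total sources by total variation times `σ t`. -/
def sourceConst (N : ℕ) (C : ℝ) : ℝ := 2 * N * (3 * C ^ 3 + C ^ 2)

/-- As long as the total variation is at most `A`, the total sources are `O(A σ t)`. -/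
theorem integral_abs_wave_source_le (hu : IsSmallStrip a g δ σ τ R u ut ux uxt uxx)
    (h : IsEigenframe Ω a δ lam l r) (hg : ContDiffOn ℝ ∞ g Ω) (hC : FrameBounds g δ lam l r C)
    (hσ : 0 ≤ σ) {m A : ℝ} (hm : 0 < m)
    (hgap : ∀ i j, i < j → ∀ v ∈ Metric.closedBall (0 : RN N) δ, m ≤ lam j v - lam i v)
    (p : Fin N) (h0 : ∀ i, i ≠ p → ∀ x, wave l u ux i 0 x = 0)
    (hA : ∀ s ∈ Icc 0 τ, ∫ x in (-R)..R, ‖ux s x‖ ≤ A)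
    (hsmall : 4 * (N : ℝ) ^ 2 * A * (2 * C ^ 4) ≤ m) {t : ℝ} (ht : t ∈ Icc 0 τ) (i : Fin N) :
    ∫ s in 0..t, ∫ x in (-R)..R, |transportSource (wave l u ux i) (waveDeriv l u ux ut uxt i)
      (waveDeriv l u ux ux uxx i) (fun t x => lam i (u t x))
      (fun t x => fderiv ℝ (lam i) (u t x) (ux t x)) s x| ≤ A * sourceConst N C * (σ * t) := by
  have hC0 := hC.nonneg
  have hR : -R ≤ R := by linarith [hu.radius_pos]
  have cux := hu.cont_x
  have hA0 : 0 ≤ A := (integral_nonneg hR fun x _ => norm_nonneg _).trans (hA t ht)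
  have hw : ∀ i, ∀ s ∈ Icc 0 τ, ∫ x in (-R)..R, |wave l u ux i s x| ≤ A := fun i s hs => by
    have := (hu.isTransport h i).cont
    exact (integral_mono_on hR (Continuous.intervalIntegrable (by fun_prop) _ _)
      (Continuous.intervalIntegrable (by fun_prop) _ _)
      fun x _ => hu.abs_wave_le h i s x).trans (hA s hs)
  refine (integral_abs_source_le (fun i => hu.isTransport h i) (m := m) (A := A)
    (B := 2 * C ^ 4) (b := σ * (3 * C ^ 3 + C ^ 2)) hm hA0 (by positivity) (by positivity) ?_ p h0
    (fun i t ht x => hu.abs_source_le h hg hC hσ i ht x) hw (by simpa using hsmall) ht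
    i).trans_eq ?_
  · intro i j hij
    rcases lt_or_gt_of_ne hij with hlt | hlt
    · exact Or.inr fun t x => hgap i j hlt _ (hu.mem t x)
    · exact Or.inl fun t x => hgap j i hlt _ (hu.mem t x)
  · rw [sourceConst, Fintype.card_fin]; ring

/-- The total variation is controlled by the initial mass of the `p`-th wave and the total sources.
-/
theorem integral_norm_deriv_x_le (hu : IsSmallStrip a g δ σ τ R u ut ux uxt uxx)
    (h : IsEigenframe Ω a δ lam l r) (hC : FrameBounds g δ lam l r C) {A₀ G : ℝ}
    (p : Fin N) (h0 : ∀ i, i ≠ p → ∀ x, wave l u ux i 0 x = 0)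
    (hp : ∫ x in (-R)..R, |wave l u ux p 0 x| ≤ A₀) {t : ℝ} (ht : t ∈ Icc 0 τ)
    (hsrc : ∀ i, ∫ s in 0..t, ∫ x in (-R)..R, |transportSource (wave l u ux i)
      (waveDeriv l u ux ut uxt i) (waveDeriv l u ux ux uxx i) (fun t x => lam i (u t x))
      (fun t x => fderiv ℝ (lam i) (u t x) (ux t x)) s x| ≤ G) :
    ∫ x in (-R)..R, ‖ux t x‖ ≤ C * (A₀ + N * G) := by
  have hR : -R ≤ R := by linarith [hu.radius_pos]
  have cux := hu.cont_x
  have cw : ∀ i, Continuous fun q : ℝ × ℝ => wave l u ux i q.1 q.2 := fun i =>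
    (hu.isTransport h i).cont
  have cwi : ∀ i, Continuous fun x => |wave l u ux i t x| := fun i => by have := cw i; fun_prop
  have cs : Continuous fun x => C * ∑ i, |wave l u ux i t x| :=
    continuous_const.mul (continuous_finsetSum _ fun i _ => cwi i)
  have e1 : ∫ x in (-R)..R, ‖ux t x‖ ≤ ∫ x in (-R)..R, C * ∑ i, |wave l u ux i t x| :=
    integral_mono_on hR (Continuous.intervalIntegrable (by fun_prop) _ _)
      (cs.intervalIntegrable _ _) fun x _ => hu.norm_deriv_x_le h hC t x
  rw [intervalIntegral.integral_const_mul, intervalIntegral.integral_finsetSum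
    fun i _ => (cwi i).intervalIntegrable _ _] at e1
  refine e1.trans (mul_le_mul_of_nonneg_left ?_ hC.nonneg)
  have e2 : ∀ i, ∫ x in (-R)..R, |wave l u ux i t x| ≤ (if i = p then A₀ else 0) + G := fun i => by
    refine ((hu.isTransport h i).integral_abs_le ht).trans (add_le_add ?_ (hsrc i))
    split_ifs with hi
    · rw [hi]; exact hp
    · simp [h0 i hi]
  refine (Finset.sum_le_sum fun i _ => e2 i).trans_eq ?_
  simp [Finset.sum_add_distrib]

end IsSmallStrip

/-! ### Characteristics -/

theorem exists_characteristic {τ C : ℝ} {K : ℝ≥0} {f : ℝ → ℝ → ℝ} (hτ : 0 ≤ τ)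
    (hf : Continuous fun q : ℝ × ℝ => f q.1 q.2) (hC : ∀ t x, |f t x| ≤ C)
    (hK : ∀ t ∈ Icc 0 τ, LipschitzWith K (f t)) (y : ℝ) :
    ∃ X : ℝ → ℝ, X 0 = y ∧ (∀ t ∈ Icc 0 τ, HasDerivWithinAt X (f t (X t)) (Icc 0 τ) t) ∧
      ∀ t ∈ Icc 0 τ, |X t - y| ≤ C * t := by
  have hC0 : 0 ≤ C := (abs_nonneg _).trans (hC 0 0)
  have hP : IsPicardLindelof f (tmin := 0) (tmax := τ) ⟨0, le_rfl, hτ⟩ y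
      (Real.toNNReal (C * τ)) 0 (Real.toNNReal C) K :=
    { lipschitzOnWith := fun t ht => (hK t ht).lipschitzOnWith
      continuousOn := fun x _ => Continuous.continuousOn (by fun_prop)
      norm_le := fun t _ x _ => by rw [Real.coe_toNNReal _ hC0]; exact hC t x
      mul_max_le := by
        rw [Real.coe_toNNReal _ hC0, Real.coe_toNNReal _ (by positivity)]
        simp [hτ] }
  obtain ⟨X, hX0, hX⟩ := hP.exists_eq_forall_mem_Icc_hasDerivWithinAt₀
  have hX0 : X 0 = y := hX0
  refine ⟨X, hX0, hX, fun t ht => ?_⟩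
  have := norm_image_sub_le_of_norm_deriv_le_segment' (C := C) hX (fun s _ => hC s _) t ht
  rwa [hX0, sub_zero] at this

/-- Characteristics do not cross, by uniqueness for the differential equation. -/
theorem characteristics_lt {τ : ℝ} {K : ℝ≥0} {f : ℝ → ℝ → ℝ}
    (hK : ∀ t ∈ Icc 0 τ, LipschitzWith K (f t)) {X Y : ℝ → ℝ}
    (hX : ∀ t ∈ Icc 0 τ, HasDerivWithinAt X (f t (X t)) (Icc 0 τ) t)
    (hY : ∀ t ∈ Icc 0 τ, HasDerivWithinAt Y (f t (Y t)) (Icc 0 τ) t)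
    (h0 : X 0 < Y 0) {t : ℝ} (ht : t ∈ Icc 0 τ) : X t < Y t := by
  by_contra! hle
  have cX : ContinuousOn X (Icc 0 τ) := fun s hs => (hX s hs).continuousWithinAt
  have cY : ContinuousOn Y (Icc 0 τ) := fun s hs => (hY s hs).continuousWithinAt
  have hsub : Icc 0 t ⊆ Icc 0 τ := Icc_subset_Icc le_rfl ht.2
  -- If the curves met, backward uniqueness from the meeting time would give `X 0 = Y 0`.
  obtain ⟨s, hs, hse⟩ := intermediate_value_Icc' ht.1 ((cY.sub cX).mono hsub)
    (show (0 : ℝ) ∈ Icc (Y t - X t) (Y 0 - X 0) from ⟨by linarith, by linarith⟩)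
  have hse : Y s - X s = 0 := hse
  have hsτ : Icc 0 s ⊆ Icc 0 τ := Icc_subset_Icc le_rfl (hs.2.trans ht.2)
  have hnh : ∀ q ∈ Ioc 0 s, Icc 0 τ ∈ nhdsWithin q (Iic q) := fun q hq =>
    Filter.mem_of_superset (Icc_mem_nhdsLE hq.1) (Icc_subset_Icc le_rfl (hsτ ⟨hq.1.le, hq.2⟩).2)
  have := ODE_solution_unique_of_mem_Icc_left (v := f) (s := fun _ => univ) (K := K) (a := 0)
    (b := s) (f := X) (g := Y)
    (fun q hq => (hK q (hsτ ⟨hq.1.le, hq.2⟩)).lipschitzOnWith) (cX.mono hsτ)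
    (fun q hq => (hX q (hsτ ⟨hq.1.le, hq.2⟩)).mono_of_mem_nhdsWithin (hnh q hq))
    (fun _ _ => mem_univ _) (cY.mono hsτ)
    (fun q hq => (hY q (hsτ ⟨hq.1.le, hq.2⟩)).mono_of_mem_nhdsWithin (hnh q hq))
    (fun _ _ => mem_univ _) (by linarith)
  have h00 : X 0 = Y 0 := this ⟨le_rfl, hs.1⟩
  linarith

namespace IsTransport

variable {τ R : ℝ} {w wt wx c cx : ℝ → ℝ → ℝ}

/-- The mass to the left of a characteristic changes only through the source: the flux across the
characteristic vanishes. -/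
theorem hasDerivAt_primitive_along (h : IsTransport τ R w wt wx c cx) {X : ℝ → ℝ} {t : ℝ}
    (ht : t ∈ Ioo 0 τ) (hX : HasDerivAt X (c t (X t)) t) :
    HasDerivAt (fun s => ∫ y in (-R)..X s, w s y)
      (∫ y in (-R)..X t, transportSource w wt wx c cx t y) t := by
  have h1 := h.cont; have h2 := h.continuous_source; have h3 := h.cont_speed
  have cS : Continuous fun q : ℝ × ℝ => ∫ y in (-R)..q.2, transportSource w wt wx c cx q.1 y :=
    continuous_parametric_primitive_of_continuous (f := transportSource w wt wx c cx) h2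
  have hev : ∀ᶠ v : ℝ × ℝ in nhds (t, X t), v.1 ∈ Ioo 0 τ :=
    continuousAt_fst.eventually (Ioo_mem_nhds ht.1 ht.2)
  have hF := hasStrictFDerivAt_uncurry_coprod (𝕜 := ℝ) (u := (t, X t))
    (f := fun s x => ∫ y in (-R)..x, w s y)
    (f₁ := fun s x => ContinuousLinearMap.toSpanSingleton ℝ
      ((∫ y in (-R)..x, transportSource w wt wx c cx s y) - c s x * w s x))
    (f₂ := fun s x => ContinuousLinearMap.toSpanSingleton ℝ (w s x))
    (by
      filter_upwards [hev] with v hv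
      exact (h.hasDerivAt_primitive hv v.2).hasFDerivAt)
    (Filter.Eventually.of_forall fun v => by
      have hc : Continuous (w v.1) := by fun_prop
      exact (integral_hasDerivAt_right (hc.intervalIntegrable _ _)
        (hc.stronglyMeasurableAtFilter _ _) hc.continuousAt).hasFDerivAt)
    (((ContinuousLinearMap.toSpanSingletonCLE (𝕜 := ℝ) (E := ℝ)).continuous.comp
      (cS.sub (h3.mul h1))).continuousAt)
    (((ContinuousLinearMap.toSpanSingletonCLE (𝕜 := ℝ) (E := ℝ)).continuous.comp h1).continuousAt)
  have := hF.hasFDerivAt.comp_hasDerivAt t ((hasDerivAt_id t).prodMk hX)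
  refine this.congr_deriv ?_
  simp [Function.HasUncurry.uncurry]

theorem abs_primitive_along_sub_le (h : IsTransport τ R w wt wx c cx) {X : ℝ → ℝ}
    (hX : ∀ t ∈ Icc 0 τ, HasDerivWithinAt X (c t (X t)) (Icc 0 τ) t)
    (hXR : ∀ t ∈ Icc 0 τ, X t ∈ Icc (-R) R) {t : ℝ} (ht : t ∈ Icc 0 τ) :
    |(∫ y in (-R)..X t, w t y) - ∫ y in (-R)..X 0, w 0 y| ≤
      ∫ s in 0..t, ∫ x in (-R)..R, |transportSource w wt wx c cx s x| := by
  have h1 := h.cont; have h2 := h.continuous_source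
  have cX : ContinuousOn X (Icc 0 τ) := fun s hs => (hX s hs).continuousWithinAt
  have hsub : Icc 0 t ⊆ Icc 0 τ := Icc_subset_Icc le_rfl ht.2
  have cS : Continuous fun q : ℝ × ℝ => ∫ y in (-R)..q.2, transportSource w wt wx c cx q.1 y :=
    continuous_parametric_primitive_of_continuous (f := transportSource w wt wx c cx) h2
  have cP : Continuous fun q : ℝ × ℝ => ∫ y in (-R)..q.2, w q.1 y :=
    continuous_parametric_primitive_of_continuous (f := w) h1
  have cX' : ContinuousOn (fun s => (s, X s)) (Icc 0 t) := continuousOn_id.prodMk (cX.mono hsub)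
  have cSX := cS.comp_continuousOn cX'
  have e := integral_eq_sub_of_hasDerivAt_of_le ht.1 (cP.comp_continuousOn cX')
    (fun s hs => h.hasDerivAt_primitive_along ⟨hs.1, hs.2.trans_le ht.2⟩
      ((hX s (hsub (Ioo_subset_Icc_self hs))).hasDerivAt
        (Icc_mem_nhds hs.1 (hs.2.trans_le ht.2)))) (cSX.intervalIntegrable_of_Icc ht.1)
  simp only [Function.comp_apply] at e
  rw [← e]
  refine (abs_integral_le_integral_abs ht.1).trans ?_
  refine integral_mono_on ht.1 (cSX.abs.intervalIntegrable_of_Icc ht.1)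
    (Continuous.intervalIntegrable (by fun_prop) _ _) fun s hs => ?_
  exact abs_primitive_le (by fun_prop) (by fun_prop) (fun _ => le_rfl) (hXR s (hsub hs))

end IsTransport

/-! ### Tubes between two characteristics of one family -/

namespace IsSmallStrip

variable {N : ℕ} {Ω : Set (RN N)} {a : RN N → Matrix (Fin N) (Fin N) ℝ} {g : RN N → RN N}
  {δ σ τ R C : ℝ} {lam : Fin N → RN N → ℝ} {l r : Fin N → RN N → RN N}
  {u ut ux uxt uxx : ℝ → ℝ → RN N}

theorem hasDerivAt_speed (hu : IsSmallStrip a g δ σ τ R u ut ux uxt uxx)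
    (h : IsEigenframe Ω a δ lam l r) (p : Fin N) (t x : ℝ) :
    HasDerivAt (fun x => lam p (u t x)) (fderiv ℝ (lam p) (u t x) (ux t x)) x :=
  (hasFDerivAt_comp (h.smooth_lam p) (h.closedBall_subset (hu.mem t x))).comp_hasDerivAt x
    (hu.deriv_x t x)

theorem exists_lipschitz_speed (hu : IsSmallStrip a g δ σ τ R u ut ux uxt uxx)
    (h : IsEigenframe Ω a δ lam l r) (p : Fin N) :
    ∃ K : ℝ≥0, ∀ t ∈ Icc 0 τ, LipschitzWith K (fun x => lam p (u t x)) := by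
  have hT := hu.isTransport h p
  have hS : IsCompact (Icc 0 τ ×ˢ Icc (-R) R) := isCompact_Icc.prod isCompact_Icc
  obtain ⟨B, hB⟩ := hS.exists_bound_of_continuousOn hT.cont_speed_x.continuousOn
  refine ⟨Real.toNNReal |B|, fun t ht => lipschitzWith_of_nnnorm_deriv_le
    (fun x => (hu.hasDerivAt_speed h p t x).differentiableAt) fun x => ?_⟩
  rw [(hu.hasDerivAt_speed h p t x).deriv, ← NNReal.coe_le_coe, coe_nnnorm,
    Real.coe_toNNReal _ (abs_nonneg B)]
  by_cases hx : R ≤ |x|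
  · simp [hu.supp_x t x hx]
  · exact (hB (t, x) ⟨ht, abs_le.1 (not_le.1 hx).le⟩).trans (le_abs_self B)

/-- The derivative `∂_x λ_p(u)` is `⟨Dλ_p(0), r_p(0)⟩ w_p` up to the waves of the other families
and an error that is small with `u`. -/
theorem abs_speed_deriv_sub_le (hu : IsSmallStrip a g δ σ τ R u ut ux uxt uxx)
    (h : IsEigenframe Ω a δ lam l r) (hC : FrameBounds g δ lam l r C) (p : Fin N) {A : ℝ} {t x : ℝ}
    (hU : ‖u t x‖ ≤ A) :
    |fderiv ℝ (lam p) (u t x) (ux t x) - fderiv ℝ (lam p) 0 (r p 0) * wave l u ux p t x| ≤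
      C * A * |wave l u ux p t x| + C ^ 2 * ∑ k ∈ Finset.univ.erase p, |wave l u ux k t x| := by
  have hv := hu.mem t x
  have hC0 := hC.nonneg
  set L := fderiv ℝ (lam p) (u t x) with hL
  have eux : L (ux t x) = ∑ k, wave l u ux k t x * L (r k (u t x)) := by
    conv_lhs => rw [← h.sum_inner_smul (h.closedBall_subset hv) (ux t x)]
    simp [map_sum, wave]
  have e : L (ux t x) - fderiv ℝ (lam p) 0 (r p 0) * wave l u ux p t x =
      wave l u ux p t x * (L (r p (u t x)) - fderiv ℝ (lam p) 0 (r p 0)) +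
      ∑ k ∈ Finset.univ.erase p, wave l u ux k t x * L (r k (u t x)) := by
    rw [eux, ← Finset.add_sum_erase _ _ (Finset.mem_univ p)]; ring
  rw [e]
  refine (abs_add_le _ _).trans (add_le_add ?_ ?_)
  · rw [abs_mul, mul_comm]
    refine mul_le_mul_of_nonneg_right ?_ (abs_nonneg _)
    exact (hC.nonlinearity p _ hv).trans (mul_le_mul_of_nonneg_left hU hC0)
  · rw [Finset.mul_sum]
    refine (Finset.abs_sum_le_sum_abs _ _).trans (Finset.sum_le_sum fun k _ => ?_)
    rw [abs_mul, mul_comm]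
    refine mul_le_mul_of_nonneg_right ?_ (abs_nonneg _)
    refine (L.le_opNorm _).trans ?_
    rw [sq]
    exact mul_le_mul (hC.speed_deriv p _ hv) (hC.right k _ hv) (norm_nonneg _) hC0

/-- A tube between two `p`-characteristics keeps its mass of `p`-waves up to the sources, and the
difference of the speeds of its two sides is the integral of `∂_x λ_p(u)` over the tube, hence
close to `⟨Dλ_p(0), r_p(0)⟩` times this mass. Since the width of the tube stays positive, its
initial width bounds the elapsed time. -/
theorem lt_width (hu : IsSmallStrip a g δ σ τ R u ut ux uxt uxx)
    (h : IsEigenframe Ω a δ lam l r) (hC : FrameBounds g δ lam l r C) (hτ : 0 ≤ τ) (p : Fin N)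
    {A G y₁ y₂ : ℝ} (hp : fderiv ℝ (lam p) 0 (r p 0) ≤ 0)
    (hU : ∀ t x, ‖u t x‖ ≤ A) (hA : ∀ t ∈ Icc 0 τ, ∫ x in (-R)..R, |wave l u ux p t x| ≤ A)
    (hk : ∀ k, k ≠ p → ∀ t ∈ Icc 0 τ, ∫ x in (-R)..R, |wave l u ux k t x| ≤ G)
    (hsrc : ∀ t ∈ Icc 0 τ, ∫ s in 0..t, ∫ x in (-R)..R, |transportSource (wave l u ux p)
      (waveDeriv l u ux ut uxt p) (waveDeriv l u ux ux uxx p) (fun t x => lam p (u t x))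
      (fun t x => fderiv ℝ (lam p) (u t x) (ux t x)) s x| ≤ G)
    (hy : y₁ < y₂) (hy₁ : |y₁| + C * τ ≤ R) (hy₂ : |y₂| + C * τ ≤ R) :
    (-fderiv ℝ (lam p) 0 (r p 0) * ((∫ x in y₁..y₂, wave l u ux p 0 x) - 2 * G) - C * A * A -
      C ^ 2 * (N * G)) * τ < y₂ - y₁ := by
  have hC0 := hC.nonneg
  have hA0 : 0 ≤ A := (norm_nonneg _).trans (hU 0 0)
  have hR : -R ≤ R := by linarith [hu.radius_pos]
  have hT := hu.isTransport h p
  have cc := hT.cont_speed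
  have ccx := hT.cont_speed_x
  have cw : ∀ i, Continuous fun q : ℝ × ℝ => wave l u ux i q.1 q.2 := fun i =>
    (hu.isTransport h i).cont
  have hG0 : 0 ≤ G := by simpa using hsrc 0 ⟨le_rfl, hτ⟩
  obtain ⟨K, hK⟩ := hu.exists_lipschitz_speed h p
  have hbd : ∀ t x, |lam p (u t x)| ≤ C := fun t x => hC.speed p _ (hu.mem t x)
  obtain ⟨X, hX0, hX, hXb⟩ := exists_characteristic hτ cc hbd hK y₁
  obtain ⟨Y, hY0, hY, hYb⟩ := exists_characteristic hτ cc hbd hK y₂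
  have hin : ∀ {Z : ℝ → ℝ} {y : ℝ}, |y| + C * τ ≤ R → (∀ t ∈ Icc 0 τ, |Z t - y| ≤ C * t) →
      ∀ t ∈ Icc 0 τ, Z t ∈ Icc (-R) R := fun {Z y} hyR hZ t ht => by
    have h1 := hZ t ht
    have h2 : C * t ≤ C * τ := mul_le_mul_of_nonneg_left ht.2 hC0
    have h3 : |Z t| ≤ |Z t - y| + |y| := by simpa using abs_add_le (Z t - y) y
    exact abs_le.1 (by linarith)
  have hXR := hin hy₁ hXb
  have hYR := hin hy₂ hYb
  have hlt : ∀ t ∈ Icc 0 τ, X t < Y t := fun t ht =>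
    characteristics_lt hK hX hY (by rw [hX0, hY0]; exact hy) ht
  set γ : ℝ := -fderiv ℝ (lam p) 0 (r p 0) with hγ
  have hγ0 : 0 ≤ γ := by linarith
  set w := wave l u ux p with hw
  set J : ℝ := ∫ x in y₁..y₂, w 0 x with hJ
  set m : ℝ := γ * (J - 2 * G) - C * A * A - C ^ 2 * (N * G) with hm
  have hcw : ∀ t, Continuous (w t) := fun t => by have := cw p; fun_prop
  have hmass : ∀ t ∈ Icc 0 τ, J - 2 * G ≤ ∫ x in X t..Y t, w t x := fun t ht => by
    have e1 := abs_le.1 ((hT.abs_primitive_along_sub_le hX hXR ht).trans (hsrc t ht))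
    have e2 := abs_le.1 ((hT.abs_primitive_along_sub_le hY hYR ht).trans (hsrc t ht))
    have s1 := integral_interval_sub_left ((hcw t).intervalIntegrable (-R) (Y t))
      ((hcw t).intervalIntegrable (μ := volume) (-R) (X t))
    have s0 := integral_interval_sub_left ((hcw 0).intervalIntegrable (-R) (Y 0))
      ((hcw 0).intervalIntegrable (μ := volume) (-R) (X 0))
    rw [hX0, hY0] at s0
    rw [hX0] at e1
    rw [hY0] at e2
    rw [← s1, hJ, ← s0]
    linarith
  have hspeed : ∀ t ∈ Icc 0 τ, lam p (u t (Y t)) - lam p (u t (X t)) ≤ -m := by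
    intro t ht
    have hXY := (hlt t ht).le
    have c1 : Continuous fun x => fderiv ℝ (lam p) (u t x) (ux t x) :=
      ccx.comp (by fun_prop : Continuous fun x : ℝ => (t, x))
    have c2 : Continuous fun x => -γ * w t x := continuous_const.mul (hcw t)
    have e1 : ∫ x in X t..Y t, fderiv ℝ (lam p) (u t x) (ux t x) =
        lam p (u t (Y t)) - lam p (u t (X t)) :=
      integral_eq_sub_of_hasDerivAt (fun x _ => hu.hasDerivAt_speed h p t x)
        (c1.intervalIntegrable _ _)
    have e2 : ∫ x in X t..Y t, fderiv ℝ (lam p) (u t x) (ux t x) =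
        (∫ x in X t..Y t, (fderiv ℝ (lam p) (u t x) (ux t x) - -γ * w t x)) +
          -γ * ∫ x in X t..Y t, w t x := by
      rw [integral_sub (c1.intervalIntegrable _ _) (c2.intervalIntegrable _ _),
        intervalIntegral.integral_const_mul]
      ring
    have ck : ∀ k, Continuous fun x => |wave l u ux k t x| := fun k => by
      have := cw k; fun_prop
    have cks : Continuous fun x => ∑ k ∈ Finset.univ.erase p, |wave l u ux k t x| :=
      continuous_finsetSum _ fun k _ => ck k
    have cH₁ : Continuous fun x => C * A * |wave l u ux p t x| := continuous_const.mul (ck p)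
    have cH₂ : Continuous fun x => C ^ 2 * ∑ k ∈ Finset.univ.erase p, |wave l u ux k t x| :=
      continuous_const.mul cks
    have cH : Continuous fun x => C * A * |wave l u ux p t x| +
        C ^ 2 * ∑ k ∈ Finset.univ.erase p, |wave l u ux k t x| := cH₁.add cH₂
    have hpt : ∀ x, |fderiv ℝ (lam p) (u t x) (ux t x) - -γ * w t x| ≤
        C * A * |wave l u ux p t x| +
        C ^ 2 * ∑ k ∈ Finset.univ.erase p, |wave l u ux k t x| := fun x => by
      rw [hγ, neg_neg]
      exact hu.abs_speed_deriv_sub_le h hC p (hU t x)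
    have e3 : ∫ x in X t..Y t, (fderiv ℝ (lam p) (u t x) (ux t x) - -γ * w t x) ≤
        C * A * A + C ^ 2 * (N * G) := by
      calc _ ≤ ∫ x in X t..Y t, (C * A * |wave l u ux p t x| +
              C ^ 2 * ∑ k ∈ Finset.univ.erase p, |wave l u ux k t x|) :=
            integral_mono_on hXY ((c1.sub c2).intervalIntegrable _ _)
              (cH.intervalIntegrable _ _) fun x _ => (le_abs_self _).trans (hpt x)
        _ ≤ ∫ x in (-R)..R, (C * A * |wave l u ux p t x| +
              C ^ 2 * ∑ k ∈ Finset.univ.erase p, |wave l u ux k t x|) :=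
            integral_mono_interval (hXR t ht).1 hXY (hYR t ht).2
              (Filter.Eventually.of_forall fun x => (abs_nonneg _).trans (hpt x))
              (cH.intervalIntegrable _ _)
        _ = C * A * (∫ x in (-R)..R, |wave l u ux p t x|) +
              C ^ 2 * ∑ k ∈ Finset.univ.erase p, ∫ x in (-R)..R, |wave l u ux k t x| := by
            rw [integral_add (cH₁.intervalIntegrable _ _) (cH₂.intervalIntegrable _ _),
              intervalIntegral.integral_const_mul, intervalIntegral.integral_const_mul,
              intervalIntegral.integral_finsetSum fun k _ => (ck k).intervalIntegrable _ _]
        _ ≤ C * A * A + C ^ 2 * (N * G) := by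
            have hs : ∑ k ∈ Finset.univ.erase p, ∫ x in (-R)..R, |wave l u ux k t x| ≤ N * G := by
              refine (Finset.sum_le_sum fun k hkp =>
                hk k (Finset.ne_of_mem_erase hkp) t ht).trans ?_
              rw [Finset.sum_const, nsmul_eq_mul]
              refine mul_le_mul_of_nonneg_right ?_ hG0
              have := Finset.card_le_univ (Finset.univ.erase p)
              rw [Fintype.card_fin] at this
              exact_mod_cast this
            have := hA t ht
            gcongr
    have := mul_le_mul_of_nonneg_left (hmass t ht) hγ0
    rw [← e1, e2, hm]
    linarith
  have cX : ContinuousOn X (Icc 0 τ) := fun s hs => (hX s hs).continuousWithinAt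
  have cY : ContinuousOn Y (Icc 0 τ) := fun s hs => (hY s hs).continuousWithinAt
  have hder : ∀ t ∈ Ioo 0 τ, HasDerivAt (fun s => Y s - X s)
      (lam p (u t (Y t)) - lam p (u t (X t))) t := fun t ht =>
    ((hY t (Ioo_subset_Icc_self ht)).hasDerivAt (Icc_mem_nhds ht.1 ht.2)).sub
      ((hX t (Ioo_subset_Icc_self ht)).hasDerivAt (Icc_mem_nhds ht.1 ht.2))
  have hfin := (convex_Icc 0 τ).image_sub_le_mul_sub_of_deriv_le (f := fun s => Y s - X s)
    (C := -m) (cY.sub cX)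
    (by
      rw [interior_Icc]
      exact fun t ht => (hder t ht).differentiableAt.differentiableWithinAt)
    (by
      rw [interior_Icc]
      intro t ht
      rw [(hder t ht).deriv]
      exact hspeed t (Ioo_subset_Icc_self ht))
    0 ⟨le_rfl, hτ⟩ τ ⟨hτ, le_rfl⟩ hτ
  have := hlt τ ⟨hτ, le_rfl⟩
  simp only [hX0, hY0, sub_zero] at hfin
  linarith

end IsSmallStrip

/-! ### Genuine nonlinearity coefficient, profile and initial data -/

/-- `γ_ppp(0) = -⟨Dλ_p(0), r_p(0)⟩`: in the derivative of `l_p a r_p(0) = λ_p l_p r_p(0)` along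
`s r_p(0)`, the terms with the derivative of `l_p` cancel because `r_p(0)` is a right eigenvector
of `a(0)`. -/
theorem IsEigenframe.gammaDiag_eq {N : ℕ} {Ω : Set (RN N)} {a : RN N → Matrix (Fin N) (Fin N) ℝ}
    {δ : ℝ} {lam : Fin N → RN N → ℝ} {l r : Fin N → RN N → RN N}
    (h : IsEigenframe Ω a δ lam l r) (hΩ : IsOpen Ω)
    (ha : ∀ m n, ContDiffOn ℝ ∞ (fun v => a v m n) Ω) (p : Fin N) :
    gammaDiag a l r p 0 = -fderiv ℝ (lam p) 0 (r p 0) := by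
  have h00 := h.zero_mem
  have hΩ0 : (0 : RN N) ∈ Ω := h.ball_subset h00
  set e := r p 0 with he
  have hline : HasDerivAt (fun s : ℝ => (0 : RN N) + s • e) e 0 := by
    simpa using ((hasDerivAt_id (0 : ℝ)).smul_const e).const_add 0
  have hcomp : ∀ {f : RN N → ℝ}, DifferentiableAt ℝ f 0 →
      HasDerivAt (fun s : ℝ => f (0 + s • e)) (fderiv ℝ f 0 e) 0 := fun {f} hf => by
    have hf' : HasFDerivAt f (fderiv ℝ f 0) ((0 : RN N) + (0 : ℝ) • e) := by
      simpa using hf.hasFDerivAt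
    exact hf'.comp_hasDerivAt 0 hline
  have hball := Metric.isOpen_ball.mem_nhds h00
  have dl : ∀ m, DifferentiableAt ℝ (fun v => l p v m) 0 := fun m =>
    (differentiableAt_euclidean.1
      (((h.smooth_l p).differentiableOn (by simp)).differentiableAt hball)) m
  have da : ∀ m n, DifferentiableAt ℝ (fun v => a v m n) 0 := fun m n =>
    ((ha m n).differentiableOn (by simp)).differentiableAt (hΩ.mem_nhds hΩ0)
  have dlam : DifferentiableAt ℝ (lam p) 0 :=
    ((h.smooth_lam p).differentiableOn (by simp)).differentiableAt hball
  set A' : Fin N → Fin N → ℝ := fun m n => fderiv ℝ (fun v => a v m n) 0 e with hA'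
  set L' : Fin N → ℝ := fun m => fderiv ℝ (fun v => l p v m) 0 e with hL'
  have d1 : HasDerivAt (fun s : ℝ => ∑ m, ∑ n, l p 0 m * a (0 + s • e) m n * e n)
      (∑ m, ∑ n, l p 0 m * A' m n * e n) 0 :=
    HasDerivAt.fun_sum fun m _ => HasDerivAt.fun_sum fun n _ =>
      ((hcomp (da m n)).const_mul _).mul_const _
  have d2 : HasDerivAt (fun s : ℝ => ∑ m, ∑ n, l p (0 + s • e) m * a (0 + s • e) m n * e n)
      (∑ m, ∑ n, (L' m * a 0 m n + l p 0 m * A' m n) * e n) 0 :=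
    HasDerivAt.fun_sum fun m _ => HasDerivAt.fun_sum fun n _ => by
      simpa using ((hcomp (dl m)).fun_mul (hcomp (da m n))).mul_const (e n)
  have d3 : HasDerivAt (fun s : ℝ => lam p (0 + s • e) * ∑ m, l p (0 + s • e) m * e m)
      (fderiv ℝ (lam p) 0 e * (∑ m, l p 0 m * e m) + lam p 0 * ∑ m, L' m * e m) 0 := by
    simpa using (hcomp dlam).fun_mul (HasDerivAt.fun_sum (u := Finset.univ)
      fun m _ => (hcomp (dl m)).mul_const (e m))
  have hev : (fun s : ℝ => ∑ m, ∑ n, l p (0 + s • e) m * a (0 + s • e) m n * e n) =ᶠ[nhds 0]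
      fun s : ℝ => lam p (0 + s • e) * ∑ m, l p (0 + s • e) m * e m := by
    have : ∀ᶠ s : ℝ in nhds 0, (0 : RN N) + s • e ∈ Metric.ball (0 : RN N) (2 * δ) :=
      hline.continuousAt.eventually (by simp only [zero_smul, add_zero]; exact hball)
    filter_upwards [this] with s hs
    rw [Finset.sum_comm, Finset.mul_sum]
    refine Finset.sum_congr rfl fun n _ => ?_
    rw [← Finset.sum_mul, h.left_eigen _ hs p n, mul_assoc]
  have key := (d2.congr_of_eventuallyEq hev.symm).unique d3
  have e1 : ∑ m, ∑ n, (L' m * a 0 m n + l p 0 m * A' m n) * e n =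
      lam p 0 * (∑ m, L' m * e m) + ∑ m, ∑ n, l p 0 m * A' m n * e n := by
    rw [Finset.mul_sum, ← Finset.sum_add_distrib]
    refine Finset.sum_congr rfl fun m _ => ?_
    have := h.right_eigen 0 h00 p m
    calc ∑ n, (L' m * a 0 m n + l p 0 m * A' m n) * e n =
        L' m * (∑ n, a 0 m n * e n) + ∑ n, l p 0 m * A' m n * e n := by
          rw [Finset.mul_sum, ← Finset.sum_add_distrib]
          exact Finset.sum_congr rfl fun n _ => by ring
      _ = _ := by rw [this]; ring
  have e2 : ∑ m, l p 0 m * e m = 1 := by simpa using h.biorthogonal 0 h00 p p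
  rw [e1, e2] at key
  rw [gammaDiag, cCoeff, d1.deriv]
  linarith

namespace IsProfile

variable {I : Set ℝ} {α : ℝ → ℝ}

theorem continuous_deriv (h : IsProfile I α) : Continuous (deriv α) :=
  h.smooth.continuous_deriv (by simp)

theorem hasDerivAt (h : IsProfile I α) (x : ℝ) : HasDerivAt α (deriv α x) x :=
  (h.smooth.differentiable (by simp) x).hasDerivAt

theorem eq_zero (h : IsProfile I α) {x : ℝ} (hx : 1 / 2 ≤ |x|) : α x = 0 := by
  by_contra hne
  have := h.support_subset (subset_tsupport α hne)
  have : |x| < 1 / 2 := abs_lt.2 ⟨by linarith [this.1], this.2⟩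
  linarith

theorem hasCompactSupport (h : IsProfile I α) : HasCompactSupport α :=
  HasCompactSupport.intro (isCompact_Icc (a := (-1 / 2 : ℝ)) (b := 1 / 2)) fun x hx =>
    h.eq_zero (by
      by_contra! hlt
      have := abs_lt.1 hlt
      exact hx ⟨by linarith, by linarith⟩)

theorem integrable_abs_deriv (h : IsProfile I α) : Integrable fun x => |deriv α x| :=
  (h.continuous_deriv.integrable_of_hasCompactSupport h.hasCompactSupport.deriv).abs

theorem integral_abs_deriv_le (h : IsProfile I α) {R : ℝ} (hR : 0 ≤ R) :
    ∫ x in (-R)..R, |deriv α x| ≤ ∫ x, |deriv α x| := by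
  rw [integral_of_le (by linarith)]
  exact setIntegral_le_integral h.integrable_abs_deriv
    (Filter.Eventually.of_forall fun x => abs_nonneg _)

/-- An interval on which the mean slope of the profile is at least half the maximal slope. -/
theorem exists_lt_slope (h : IsProfile I α) :
    ∃ y₁ y₂, y₁ < y₂ ∧ (⨆ x, deriv α x) / 2 * (y₂ - y₁) ≤ α y₂ - α y₁ := by
  obtain ⟨y, hy⟩ := exists_lt_of_lt_ciSup (half_lt_self h.max_pos)
  have ht : Filter.Tendsto (slope α y) (nhdsWithin y (Ioi y)) (nhds (deriv α y)) :=
    (hasDerivAt_iff_tendsto_slope.1 (h.hasDerivAt y)).mono_left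
      (nhdsWithin_mono y fun z hz => (ne_of_gt hz : z ≠ y))
  obtain ⟨z, hz, hyz⟩ := ((ht.eventually (lt_mem_nhds hy)).and self_mem_nhdsWithin).exists
  have hyz : y < z := hyz
  refine ⟨y, z, hyz, ?_⟩
  rw [slope_def_field, lt_div_iff₀ (sub_pos.2 hyz)] at hz
  exact hz.le

end IsProfile

section
variable {N : ℕ} {δ ε : ℝ} {rp : RN N → RN N} {I : Set ℝ} {U : ℝ → RN N} {α : ℝ → ℝ}

theorem IsIntegralCurveThroughZero.mul_mem (hU : IsIntegralCurveThroughZero rp δ I U)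
    (hα : IsProfile I α) (hε : ε ∈ Icc (0 : ℝ) 1) (x : ℝ) : ε * α x ∈ I := by
  have hseg : segment ℝ 0 (α x) ⊆ I :=
    hU.ordConnected.convex.segment_subset hU.zero_mem (hα.range_subset x)
  exact hseg ⟨1 - ε, ε, by linarith [hε.2], hε.1, by ring, by simp⟩

theorem IsIntegralCurveThroughZero.hasDerivAt_comp (hU : IsIntegralCurveThroughZero rp δ I U)
    (hα : IsProfile I α) (hε : ε ∈ Icc (0 : ℝ) 1) (x : ℝ) :
    HasDerivAt (fun x => U (ε * α x)) ((ε * deriv α x) • rp (U (ε * α x))) x :=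
  (hU.hasDerivAt _ (hU.mul_mem hα hε x)).scomp x ((hα.hasDerivAt x).const_mul ε)

end

/-- A `C²` solution on `[0, T] × ℝ`, extended by clamping the time, together with its derivatives.
-/
theorem IsC2Solution.exists_isC2Strip {N : ℕ} {Ω : Set (RN N)}
    {a : RN N → Matrix (Fin N) (Fin N) ℝ} {g : RN N → RN N} {σ T : ℝ} {u0 : ℝ → RN N}
    {u : ℝ → ℝ → RN N} (h : IsC2Solution Ω a g σ u0 T u) (hT : 0 < T) :
    ∃ v vt vx vxt vxx : ℝ → ℝ → RN N, IsC2Strip T v vt vx vxt vxx ∧ (∀ t x, v t x ∈ Ω) ∧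
      (∀ t ∈ Ioo 0 T, ∀ x m, vt t x m + ∑ n, a (v t x) m n * vx t x n = σ * g (v t x) m) ∧
      ∀ x, v 0 x = u0 x := by
  obtain ⟨v, vt, vx, vxt, vxx, hv, huv⟩ := ContDiffOn.exists_isC2Strip hT h.contDiffOn
  have hI : ∀ t ∈ Icc 0 T, v t = u t := fun t ht => by
    funext x; rw [huv, clamp_of_mem ht]
  refine ⟨v, vt, vx, vxt, vxx, hv, fun t x => ?_, fun t ht x m => ?_, fun x => ?_⟩
  · rw [huv]; exact h.mem _ (clamp_mem hT.le t) x
  · have heq := h.equation t ht x m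
    have e1 : deriv (fun s => u s x) t = vt t x := by
      refine ((hv.deriv_t t ht x).congr_of_eventuallyEq ?_).deriv
      filter_upwards [Ioo_mem_nhds ht.1 ht.2] with s hs
      rw [hI s (Ioo_subset_Icc_self hs)]
    have e2 : deriv (fun y => u t y) x = vx t x := by
      rw [← hI t (Ioo_subset_Icc_self ht)]
      exact (hv.deriv_x t x).deriv
    rwa [e1, e2, ← hI t (Ioo_subset_Icc_self ht)] at heq
  · rw [hI 0 ⟨le_rfl, hT.le⟩, h.initial]

/-! ### Upper bound for the lifespan -/

namespace IsC2Strip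

variable {E : Type*} [NormedAddCommGroup E] [NormedSpace ℝ E] {T R : ℝ}
  {u ut ux uxt uxx : ℝ → ℝ → E}

theorem deriv_x_eq_zero (hu : IsC2Strip T u ut ux uxt uxx) {t x ρ : ℝ}
    (h : ∀ y, ρ < |y| → u t y = 0) (hx : ρ < |x|) : ux t x = 0 := by
  have hev : u t =ᶠ[nhds x] fun _ => 0 := by
    filter_upwards [continuous_abs.continuousAt.eventually (lt_mem_nhds hx)] with y hy
    exact h y hy
  exact (hu.deriv_x t x).unique ((hasDerivAt_const x (0 : E)).congr_of_eventuallyEq hev)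

/-- A function that vanishes for `|x| ≥ R` is bounded by its total variation. -/
theorem norm_le_integral [CompleteSpace E] (hu : IsC2Strip T u ut ux uxt uxx) {t : ℝ}
    (hR : 0 ≤ R) (h : ∀ y, R ≤ |y| → u t y = 0) (x : ℝ) :
    ‖u t x‖ ≤ ∫ y in (-R)..R, ‖ux t y‖ := by
  have c := hu.cont_x
  have hRR : -R ≤ R := by linarith
  by_cases hx : R ≤ |x|
  · rw [h x hx, norm_zero]
    exact integral_nonneg hRR fun y _ => norm_nonneg _
  have hx' := abs_le.1 (not_le.1 hx).le
  have e : ∫ y in (-R)..x, ux t y = u t x := by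
    rw [integral_eq_sub_of_hasDerivAt (fun y _ => hu.deriv_x t y)
      (Continuous.intervalIntegrable (by fun_prop) _ _),
      h (-R) (by rw [abs_neg]; exact le_abs_self R), sub_zero]
  rw [← e]
  refine (intervalIntegral.norm_integral_le_integral_norm hx'.1).trans ?_
  exact integral_mono_interval le_rfl hx'.1 hx'.2
    (Filter.Eventually.of_forall fun y => norm_nonneg _)
    (Continuous.intervalIntegrable (by fun_prop) _ _)

end IsC2Strip

theorem exists_small_pos (s : Finset (ℝ × ℝ)) (hs : ∀ q ∈ s, 0 < q.2) :
    ∃ ν : ℝ, 0 < ν ∧ ν ≤ 1 ∧ ∀ q ∈ s, q.1 * ν < q.2 := by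
  have h1 : ∀ᶠ ν : ℝ in nhdsWithin 0 (Ioi 0), ν ≤ 1 :=
    mem_nhdsWithin_of_mem_nhds (Iic_mem_nhds one_pos)
  have h2 : ∀ᶠ ν : ℝ in nhdsWithin 0 (Ioi 0), ∀ q ∈ s, q.1 * ν < q.2 := by
    rw [Filter.eventually_all_finset]
    intro q hq
    refine mem_nhdsWithin_of_mem_nhds ?_
    exact (Continuous.continuousAt (by fun_prop : Continuous fun ν : ℝ => q.1 * ν)).eventually
      (gt_mem_nhds (by simpa using hs q hq))
  obtain ⟨ν, ⟨ha, hb⟩, hc⟩ := ((h1.and h2).and self_mem_nhdsWithin).exists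
  exact ⟨ν, hc, ha, hb⟩

theorem mainTheorem2 {N : ℕ} (Ω : Set (RN N)) (hΩ : IsOpen Ω) (h0 : (0 : RN N) ∈ Ω)
    (a : RN N → Matrix (Fin N) (Fin N) ℝ) (g : RN N → RN N)
    (ha : ∀ m n, ContDiffOn ℝ ∞ (fun v => a v m n) Ω) (hg : ContDiffOn ℝ ∞ g Ω)
    (hA1 : OnlyRealSimpleEigenvalues (a 0)) (hA3 : g 0 = 0)
    (δ : ℝ) (lam : Fin N → RN N → ℝ) (l r : Fin N → RN N → RN N)
    (hframe : IsEigenframe Ω a δ lam l r)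
    (p : Fin N) (hA2 : fderiv ℝ (lam p) 0 (r p 0) < 0)
    (I : Set ℝ) (U : ℝ → RN N) (hU : IsIntegralCurveThroughZero (r p) δ I U)
    (α : ℝ → ℝ) (hα : IsProfile I α) :
    ∃ ν : ℝ, 0 < ν ∧ ν ≤ 1 ∧
      ∀ ε κ : ℝ, ε ∈ Ioc 0 ν → κ ∈ Ioc 0 ν →
        ∀ (T : ℝ) (u : ℝ → ℝ → RN N), 0 < T →
          IsC2Solution Ω a g (ε * κ) (fun x => U (ε * α x)) T u →
            T < 3 / 4 * (4 / (gammaDiag a l r p 0 * ⨆ x, deriv α x)) * ε⁻¹ := by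
  obtain ⟨C, hC⟩ := hframe.exists_frameBounds hg
  obtain ⟨m, hm, hgap⟩ := hframe.exists_gap
  obtain ⟨y₁, y₂, hy, hslope⟩ := hα.exists_lt_slope
  rw [hframe.gammaDiag_eq hΩ ha p]
  have hC0 := hC.nonneg
  -- `M` is the maximal slope, `A₀` the total variation of the profile, `H / ε` the time to be
  -- excluded. Up to that time the total variation stays below `B ε` and the total sources below
  -- `D κ ε`.
  set γ : ℝ := -fderiv ℝ (lam p) 0 (r p 0) with hγ
  have hγ0 : 0 < γ := by linarith
  set M : ℝ := ⨆ x, deriv α x with hM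
  have hM0 : 0 < M := hα.max_pos
  set d : ℝ := y₂ - y₁ with hd
  have hd0 : 0 < d := sub_pos.2 hy
  set A₀ : ℝ := ∫ x, |deriv α x| with hA₀
  have hA₀0 : 0 ≤ A₀ := integral_nonneg fun x => abs_nonneg _
  set H : ℝ := 3 / (γ * M) with hH
  have hH0 : 0 < H := by positivity
  set B : ℝ := C * A₀ + 1 with hB
  have hB0 : 0 < B := by positivity
  set S : ℝ := IsSmallStrip.sourceConst N C with hS
  have hS0 : 0 ≤ S := by rw [hS, IsSmallStrip.sourceConst]; positivity
  set D : ℝ := B * S * H with hD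
  have hD0 : 0 ≤ D := by positivity
  -- Smallness conditions: values remain in the ball, interactions are absorbed, the total variation
  -- bound is self-improving, and the errors in the width of the tube are below half of its width.
  obtain ⟨ν, hν0, hν1, hν⟩ := exists_small_pos
    {(B, δ), (4 * (N : ℝ) ^ 2 * B * (2 * C ^ 4), m), (C * N * D, 1),
      ((2 * γ * D + C * B ^ 2 + C ^ 2 * (N * D)) * H, d / 2)}
    (by
      have := hframe.pos
      simp only [Finset.mem_insert, Finset.mem_singleton]
      rintro q (rfl | rfl | rfl | rfl) <;> simp only <;> positivity)
  have n1 : B * ν < δ := hν (B, δ) (by simp)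
  have n2 : 4 * (N : ℝ) ^ 2 * B * (2 * C ^ 4) * ν < m := hν (_, m) (by simp)
  have n3 : C * N * D * ν < 1 := hν (C * N * D, 1) (by simp)
  have n4 : (2 * γ * D + C * B ^ 2 + C ^ 2 * (N * D)) * H * ν < d / 2 := hν (_, d / 2) (by simp)
  refine ⟨ν, hν0, hν1, fun ε κ hε hκ T u hT hu => ?_⟩
  by_contra! hTge
  have hε0 : 0 < ε := hε.1
  have hκ0 : 0 < κ := hκ.1
  have hεI : ε ∈ Icc (0 : ℝ) 1 := ⟨hε0.le, hε.2.trans hν1⟩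
  set T' : ℝ := H / ε with hT'
  have hT'0 : 0 < T' := by positivity
  have hT'T : T' ≤ T := by
    refine le_of_eq_of_le ?_ hTge
    rw [hT', hH]; field_simp
  have hεT : ε * T' = H := by rw [hT']; field_simp
  obtain ⟨v, vt, vx, vxt, vxx, hv, hvΩ, hveq, hv0⟩ := hu.exists_isC2Strip hT
  -- The initial data is a pure wave of the family `p`.
  have hv0mem : ∀ x, v 0 x ∈ Metric.ball (0 : RN N) δ := fun x => by
    rw [hv0]; exact hU.mapsTo _ (hU.mul_mem hα hεI x)
  have hv0ball : ∀ x, v 0 x ∈ Metric.ball (0 : RN N) (2 * δ) := fun x =>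
    hframe.closedBall_subset (Metric.ball_subset_closedBall (hv0mem x))
  have hvx0 : ∀ x, vx 0 x = (ε * deriv α x) • r p (v 0 x) := fun x => by
    have h1 := hU.hasDerivAt_comp hα hεI x
    have h2 := hv.deriv_x 0 x
    rw [show v 0 = fun x => U (ε * α x) from funext hv0] at h2 ⊢
    exact h2.unique h1
  have hw0 : ∀ i x, (inner ℝ (l i (v 0 x)) (vx 0 x) : ℝ) =
      if i = p then ε * deriv α x else 0 := fun i x => by
    rw [hvx0, inner_smul_right, hframe.inner_left_right (hv0ball x)]
    split_ifs <;> simp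
  -- Finite speed of propagation.
  -- `R` leaves room for the support and for the two characteristics starting at `y₁` and `y₂`.
  set R : ℝ := |y₁| + |y₂| + C * T' + 2 with hR
  have hR0 : 0 < R := by positivity
  have hRR : -R ≤ R := by linarith
  have hsupp' : ∀ t ∈ Icc 0 T', ∀ x, R - 1 < |x| → v t x = 0 := fun t ht x hx => by
    refine hframe.eq_zero_of_lt_abs hΩ ha hg hA3 hv hvΩ hveq (K := C) (ρ := 1 / 2) hC0
      (fun i => hC.speed i 0 (Metric.mem_closedBall_self hframe.pos.le)) (fun x hx => ?_)
      ⟨ht.1, ht.2.trans hT'T⟩ ?_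
    · rw [hv0, hα.eq_zero hx, mul_zero, hU.at_zero]
    · have h1 : C * t ≤ C * T' := mul_le_mul_of_nonneg_left ht.2 hC0
      have h2 := abs_nonneg y₁
      have h3 := abs_nonneg y₂
      linarith
  have hsupp : ∀ t ∈ Icc 0 T', ∀ x, R ≤ |x| → v t x = 0 := fun t ht x hx =>
    hsupp' t ht x (by linarith)
  have hsuppx : ∀ t ∈ Icc 0 T', ∀ x, R ≤ |x| → vx t x = 0 := fun t ht x hx =>
    hv.deriv_x_eq_zero (hsupp' t ht) (by linarith)
  have cvx := hv.cont_x
  set V : ℝ → ℝ := fun t => ∫ x in (-R)..R, ‖vx t x‖ with hV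
  have cV : Continuous V := by fun_prop
  have hvV : ∀ t ∈ Icc 0 T', ∀ x, ‖v t x‖ ≤ V t := fun t ht x =>
    hv.norm_le_integral hR0.le (hsupp t ht) x
  have hεν : B * ε ≤ δ := (mul_le_mul_of_nonneg_left hε.2 hB0.le).trans n1.le
  -- Estimates valid as long as the total variation is at most `B * ε`.
  have hsmall : ∀ τ ∈ Icc 0 T', (∀ s ∈ Icc 0 τ, V s ≤ B * ε) →
      IsSmallStrip a g δ (ε * κ) τ R (fun t => v (clamp τ t)) (fun t => vt (clamp τ t))
        (fun t => vx (clamp τ t)) (fun t => vxt (clamp τ t)) (fun t => vxx (clamp τ t)) :=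
    fun τ hτ hVτ =>
    { toIsC2Strip := hv.clamp (hτ.2.trans hT'T)
      mem := fun t x => by
        have hc := clamp_mem hτ.1 t
        rw [mem_closedBall_zero_iff]
        exact ((hvV _ ⟨hc.1, hc.2.trans hτ.2⟩ x).trans (hVτ _ hc)).trans hεν
      equation := fun t ht x n => by
        simp only [clamp_of_mem (Ioo_subset_Icc_self ht)]
        exact hveq t ⟨ht.1, ht.2.trans_le (hτ.2.trans hT'T)⟩ x n
      radius_pos := hR0
      supp := fun t x hx => by
        have hc := clamp_mem hτ.1 t
        exact hsupp _ ⟨hc.1, hc.2.trans hτ.2⟩ x hx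
      supp_x := fun t x hx => by
        have hc := clamp_mem hτ.1 t
        exact hsuppx _ ⟨hc.1, hc.2.trans hτ.2⟩ x hx }
  have hwave0 : ∀ τ ∈ Icc 0 T', ∀ i x,
      wave l (fun t => v (clamp τ t)) (fun t => vx (clamp τ t)) i 0 x =
      if i = p then ε * deriv α x else 0 := fun τ hτ i x => by
    simp only [wave, clamp_of_mem (show (0 : ℝ) ∈ Icc 0 τ from ⟨le_rfl, hτ.1⟩), hw0]
  have hwavep : ∀ τ ∈ Icc 0 T', ∫ x in (-R)..R,
      |wave l (fun t => v (clamp τ t)) (fun t => vx (clamp τ t)) p 0 x| ≤ ε * A₀ := fun τ hτ => by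
    simp only [hwave0 τ hτ, if_true, abs_mul, abs_of_pos hε0]
    rw [intervalIntegral.integral_const_mul]
    exact mul_le_mul_of_nonneg_left (hα.integral_abs_deriv_le hR0.le) hε0.le
  have hsrc : ∀ τ ∈ Icc 0 T', (∀ s ∈ Icc 0 τ, V s ≤ B * ε) → ∀ i, ∀ t ∈ Icc 0 τ,
      ∫ s in 0..t, ∫ x in (-R)..R, |transportSource
        (wave l (fun t => v (clamp τ t)) (fun t => vx (clamp τ t)) i)
        (waveDeriv l (fun t => v (clamp τ t)) (fun t => vx (clamp τ t))
          (fun t => vt (clamp τ t)) (fun t => vxt (clamp τ t)) i)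
        (waveDeriv l (fun t => v (clamp τ t)) (fun t => vx (clamp τ t))
          (fun t => vx (clamp τ t)) (fun t => vxx (clamp τ t)) i)
        (fun t x => lam i (v (clamp τ t) x))
        (fun t x => fderiv ℝ (lam i) (v (clamp τ t) x) (vx (clamp τ t) x)) s x| ≤ D * κ * ε := by
    intro τ hτ hVτ i t ht
    refine ((hsmall τ hτ hVτ).integral_abs_wave_source_le hframe hg hC (by positivity) hm hgap p
      (A := B * ε) (fun i hi x => by rw [hwave0 τ hτ, if_neg hi]) (fun s hs => ?_) ?_ ht i).trans ?_
    · simp only [clamp_of_mem hs]; exact hVτ s hs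
    · refine le_trans ?_ n2.le
      have := mul_le_mul_of_nonneg_left hε.2
        (by positivity : 0 ≤ 4 * (N : ℝ) ^ 2 * B * (2 * C ^ 4))
      linarith
    · have h1 : ε * t ≤ H := by
        rw [← hεT]; exact mul_le_mul_of_nonneg_left (ht.2.trans hτ.2) hε0.le
      have h2 := mul_le_mul_of_nonneg_left h1 (by positivity : 0 ≤ B * S * κ * ε)
      rw [hD]; linarith
  have hVlt : ∀ t ∈ Icc 0 T', V t < B * ε := by
    refine fun t ht => forall_lt_of_bootstrap cV ?_ (fun τ hτ hVτ => ?_) ht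
    · have h1 : V 0 ≤ ∫ x in (-R)..R, C * ε * |deriv α x| := by
        have := hα.continuous_deriv
        refine integral_mono_on hRR (Continuous.intervalIntegrable (by fun_prop) _ _)
          (Continuous.intervalIntegrable (by fun_prop) _ _) fun x _ => ?_
        rw [hvx0, norm_smul, Real.norm_eq_abs, abs_mul, abs_of_pos hε0]
        have h2 := hC.right p _ (Metric.ball_subset_closedBall (hv0mem x))
        have h3 := mul_le_mul_of_nonneg_left h2 (by positivity : 0 ≤ ε * |deriv α x|)
        linarith
      rw [intervalIntegral.integral_const_mul] at h1
      have h4 := mul_le_mul_of_nonneg_left (hα.integral_abs_deriv_le hR0.le)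
        (by positivity : 0 ≤ C * ε)
      have h5 : B * ε = C * ε * A₀ + ε := by rw [hB]; ring
      linarith
    · have hττ : τ ∈ Icc 0 τ := ⟨hτ.1, le_rfl⟩
      have h1 := (hsmall τ hτ hVτ).integral_norm_deriv_x_le hframe hC p
        (fun i hi x => by rw [hwave0 τ hτ, if_neg hi]) (hwavep τ hτ) hττ
        (fun i => hsrc τ hτ hVτ i τ hττ)
      simp only [clamp_of_mem hττ] at h1
      have h2 : C * N * D * κ < 1 :=
        (mul_le_mul_of_nonneg_left hκ.2 (by positivity)).trans_lt n3
      have h3 := mul_lt_mul_of_pos_right h2 hε0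
      refine h1.trans_lt ?_
      rw [hB]; linarith
  -- The tube between two `p`-characteristics collapses before `T'`.
  have hT'm : T' ∈ Icc 0 T' := ⟨hT'0.le, le_rfl⟩
  have hVle : ∀ s ∈ Icc 0 T', V s ≤ B * ε := fun s hs => (hVlt s hs).le
  have hst := hsmall T' hT'm hVle
  have hCT : 0 ≤ C * T' := by positivity
  have hwidth := hst.lt_width hframe hC hT'0.le p (A := B * ε) (G := D * κ * ε) (y₁ := y₁)
    (y₂ := y₂) hA2.le
    (fun t x => (hvV _ (clamp_mem hT'0.le t) x).trans (hVle _ (clamp_mem hT'0.le t)))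
    (fun t ht => by
      have c1 := (hst.isTransport hframe p).cont
      have c2 := hst.cont_x
      refine (integral_mono_on hRR (Continuous.intervalIntegrable (by fun_prop) _ _)
        (Continuous.intervalIntegrable (by fun_prop) _ _)
        fun x _ => hst.abs_wave_le hframe p t x).trans ?_
      simp only [clamp_of_mem ht]; exact hVle t ht)
    (fun k hk t ht => by
      refine ((hst.isTransport hframe k).integral_abs_le ht).trans ?_
      have h1 := hsrc T' hT'm hVle k t ht
      have h2 : ∫ x in (-R)..R,
          |wave l (fun t => v (clamp T' t)) (fun t => vx (clamp T' t)) k 0 x| = 0 := by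
        simp only [hwave0 T' hT'm, if_neg hk, abs_zero, intervalIntegral.integral_zero]
      rw [h2, zero_add]; exact h1)
    (fun t ht => hsrc T' hT'm hVle p t ht) hy
    (by have := abs_nonneg y₂; linarith) (by have := abs_nonneg y₁; linarith)
  have hJ : ∫ x in y₁..y₂, wave l (fun t => v (clamp T' t)) (fun t => vx (clamp T' t)) p 0 x =
      ε * (α y₂ - α y₁) := by
    simp only [hwave0 T' hT'm, if_true]
    rw [intervalIntegral.integral_const_mul, integral_eq_sub_of_hasDerivAt
      (fun x _ => hα.hasDerivAt x) (hα.continuous_deriv.intervalIntegrable _ _)]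
  rw [hJ, ← hγ, ← hd] at hwidth
  have e1 : (γ * (ε * (α y₂ - α y₁) - 2 * (D * κ * ε)) - C * (B * ε) * (B * ε) -
      C ^ 2 * (N * (D * κ * ε))) * T' =
      γ * (α y₂ - α y₁) * H - (2 * γ * D * κ + C * B ^ 2 * ε + C ^ 2 * (N * D) * κ) * H := by
    rw [← hεT]; ring
  -- The tube would have to lose `3 / 2` of its width, with an error below `1 / 2` of it.
  have e2 : 3 / 2 * d ≤ γ * (α y₂ - α y₁) * H := by
    have h1 := mul_le_mul_of_nonneg_left hslope (by positivity : 0 ≤ γ * H)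
    have h2 : γ * H * (M / 2 * d) = 3 / 2 * d := by rw [hH]; field_simp
    linarith
  have e3 : (2 * γ * D * κ + C * B ^ 2 * ε + C ^ 2 * (N * D) * κ) * H ≤
      (2 * γ * D + C * B ^ 2 + C ^ 2 * (N * D)) * H * ν := by
    have h1 := mul_le_mul_of_nonneg_left hκ.2 (by positivity : 0 ≤ 2 * γ * D * H)
    have h2 := mul_le_mul_of_nonneg_left hε.2 (by positivity : 0 ≤ C * B ^ 2 * H)
    have h3 := mul_le_mul_of_nonneg_left hκ.2 (by positivity : 0 ≤ C ^ 2 * (N * D) * H)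
    linarith
  rw [e1] at hwidth
  linarith

end
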